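/- Fix an o-minimal structure on $(\mathbb{R},<)$; "definable" means definable in it, with real parameters. For a definable set $A\subseteq\mathbb{R}^m$, $\dim A$ is the largest $k$ such that some projection of $A$ to $k$ of the coordinates has nonempty interior ($\dim\emptyset=-\infty$). Subsets of $\mathbb{R}^m$ carry the induced topology. Let $X\subseteq\mathbb{R}^p$ and $Y\subseteq\mathbb{R}^q$ be such that $X\times Y$ is definable, let $(y_n)$ be a sequence in $Y$, and let $(\nu_n)$ be a sequence of Borel probability measures on $X$ converging weakly to a Borel probability measure $\nu_\infty$ on $X$. Let $\mathrm{Supp}$ denote the support in $X$. Assume that - $\mathrm{Supp}(\nu_n)\subseteq \mathrm{Supp}(\nu_\infty)$ for all sufficiently large $n$; - $\mathrm{Supp}(\nu_\infty)$ is definable, and $\nu_\infty(A)=0$ for every definable $A\subseteq \mathrm{Supp}(\nu_\infty)$ with $\dim A<\dim \mathrm{Supp}(\nu_\infty)$. Then the following hold. 1. Let $V\subseteq X\times Y$ be definable with $\mathrm{Supp}(\nu_n)\times\{y_n\}\subseteq V$ for all sufficiently large $n$. Then for all sufficiently large $n$, $$\dim\bigl((\mathrm{Supp}(\nu_\infty)\times\{y_n\})\cap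 V\bigr)=\dim \mathrm{Supp}(\nu_\infty),$$ and $V$ contains a nonempty relatively open subset of $\mathrm{Supp}(\nu_\infty)\times\{y_n\}$. 2. Suppose that $X$ has a definable Lie group structure, i.e. a group law $(x_1,x_2)\mapsto x_1\cdot x_2$ whose graph is definable and for which $X$, with its induced topology, is a (finite-dimensional, smooth, real) Lie group. Let $x_n\to x_\infty$ be a convergent sequence in $X$, and let $V\subseteq X\times Y$ be definable with $(\mathrm{Supp}(\nu_n)\cdot x_n)\times\{y_n\}\subseteq V$ for all sufficiently large $n$. Then for all sufficiently large $n$, $$\dim\bigl(((\mathrm{Supp}(\nu_\infty)\cdot x_n)\times\{y_n\})\cap V\bigr)=\dim \mathrm{Supp}(\nu_\infty),$$ and $V$ contains a nonempty relatively open subset of $(\mathrm{Supp}(\nu_\infty)\cdot x_n)\times\{y_n\}$. -/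

import Mathlib

open Set Filter MeasureTheory
open scoped Topology Manifold ContDiff

universe u v

/-- Definability in the structure on `ℝ` given by the language `L`, with arbitrary real parameters. -/
def IsDef (L : FirstOrder.Language.{u, v}) [L.Structure ℝ] {ι : Type} (A : Set (ι → ℝ)) : Prop :=
  (Set.univ : Set ℝ).Definable L A

/-- The structure on `ℝ` given by `L` is o-minimal: the usual order is definable, and the definable
subsets of the line are exactly the finite unions of points and of open intervals whose
endpoints lie in `ℝ ∪ {-∞, +∞}`
(that all such unions are definable follows from the definability of the order). -/
structure IsOMinimal (L : FirstOrder.Language.{u, v}) [L.Structure ℝ] : Prop where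
  definable_lt : (Set.univ : Set ℝ).Definable₂ L {z : ℝ × ℝ | z.1 < z.2}
  finite_union : ∀ A : Set ℝ, (Set.univ : Set ℝ).Definable₁ L A →
    ∃ C : Set (Set ℝ), C.Finite ∧ A = ⋃₀ C ∧
      ∀ I ∈ C, (∃ a : ℝ, I = {a}) ∨
        (∃ a b : EReal, I = {t : ℝ | a < (t : EReal) ∧ (t : EReal) < b})

open Classical in
/-- The dimension of a definable set `A ⊆ ℝ^ι`: the largest number of coordinates such that the
projection of `A` to these coordinates has nonempty interior. The empty set has
dimension `⊥` (that is, `-∞`); a nonempty set has dimension at least `0`. -/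
noncomputable def defDim {ι : Type} [Fintype ι] (A : Set (ι → ℝ)) : WithBot ℕ :=
  (Finset.univ.filter fun I : Finset ι =>
    (interior ((fun (x : ι → ℝ) (i : I) => x i) '' A)).Nonempty).sup
    fun I => (I.card : WithBot ℕ)

/-- The product `A × B ⊆ ℝ^α × ℝ^β`, where `ℝ^α × ℝ^β` is written as `ℝ^(α ⊕ β)`. -/
def prodSet {α β : Type} (A : Set (α → ℝ)) (B : Set (β → ℝ)) : Set (α ⊕ β → ℝ) :=
  {z | (fun i => z (Sum.inl i)) ∈ A ∧ (fun j => z (Sum.inr j)) ∈ B}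

/-- `V` contains a nonempty relatively open subset of `E`. -/
def ContainsOpenPiece {ι : Type} (V E : Set (ι → ℝ)) : Prop :=
  ∃ U : Set (ι → ℝ), IsOpen U ∧ (U ∩ E).Nonempty ∧ U ∩ E ⊆ V

/-- The support of a measure on `X ⊆ ℝ^p` (closed in `X`), viewed as a subset of `ℝ^p`. -/
def suppIn {p : ℕ} {X : Set (Fin p → ℝ)} (ν : ProbabilityMeasure X) : Set (Fin p → ℝ) :=
  Subtype.val '' (ν : Measure X).support

/-- The right translate `Supp(ν) · x` inside a group `X ⊆ ℝ^p`, viewed as a subset of `ℝ^p`. -/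
def suppTranslate {p : ℕ} {X : Set (Fin p → ℝ)} [Group X] (ν : ProbabilityMeasure X) (x : X) :
    Set (Fin p → ℝ) :=
  Subtype.val '' ((fun s : X => s * x) '' (ν : Measure X).support)

/-- A group structure on `X ⊆ ℝ^p` makes it a definable Lie group: the graph of the multiplication
is definable, and `X`, with the topology induced from `ℝ^p`, is a finite-dimensional
smooth real Lie group. -/
def IsDefinableLieGroup (L : FirstOrder.Language.{u, v}) [L.Structure ℝ] {p : ℕ}
    (X : Set (Fin p → ℝ)) [Group X] : Prop :=
  IsDef L {z : (Fin p ⊕ Fin p) ⊕ Fin p → ℝ |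
    ∃ a b : X, z = Sum.elim (Sum.elim (a : Fin p → ℝ) (b : Fin p → ℝ))
      ((a * b : X) : Fin p → ℝ)} ∧
  ∃ (d : ℕ) (_ : ChartedSpace (EuclideanSpace ℝ (Fin d)) X),
    LieGroup 𝓘(ℝ, EuclideanSpace ℝ (Fin d)) ∞ X

/-!
The theorem is reduced to a statement about definable families. Let `S` be the support of the limit
measure. An open set that meets `S` has positive limit measure, hence eventually positive measure
for the measures of the sequence, hence eventually meets their supports
(`eventually_inter_support_nonempty`); so the members of the definable family
`W c = {s | (s, c) ∈ V}`, taken at `c = y n`, eventually meet every given relatively open piece of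
`S`. For right translates by `x n` in a definable group one takes instead the family
`W (x, y) = {s | (s * x, y) ∈ V}`, with `x` as a further parameter, and transports the conclusion
back along the definable homeomorphism `s ↦ s * x n`, which preserves the dimension
(`defDim_image_eq`).

It remains to see that a definable family which eventually meets every relatively open piece of `S`
eventually meets `S` in full dimension and contains a piece of `S`
(`eventually_defDim_inter_eq`). Some relatively open piece of `S` is the graph of a continuous map
over an open box in `dim S` of the coordinates (`exists_graph_piece`), which reduces the claim to
subsets of a box. For a definable family of subsets of a box there are finitely many open sets such
that each member without interior misses one of them (`exists_finite_open_missed`); so a member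
that meets all of them has interior.

The o-minimal input rests on one idea: since the structure lives on the real line, the Baire
category theorem applies. The frontier of a definable set has empty interior
(`IsDef.interior_frontier_eq_empty`), so in a countable cover of an open set by definable sets one
member contains an open set (`exists_open_subset_of_countable_cover`). Quantifying over intervals
with rational endpoints then gives generic continuity of definable functions, boxes inside definable
sets whose fibres over an open base contain intervals, and generic local triviality of families of
finite sets.
Only uniform finiteness (`IsDefFam.exists_ncard_le`) is global in the parameters and needs a cell
decomposition. It is proved, together with cell decomposition and piecewise continuity, by induction
on the dimension (`cellDecomposition_and`); the cells used here are connected definable sets that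
are open or project homeomorphically to a lower-dimensional space.

That the dimension does not drop under continuous definable injections follows from
`defDim_le_of_injective`: by the intermediate value theorem a continuous function on a box has a
level set of codimension at most one, so the components of an injection can be fixed one by one.
-/

/-! ### Definable sets and first-order conditions -/

section Definability

variable {L : FirstOrder.Language.{u, v}} [L.Structure ℝ] {ι κ : Type}

namespace IsDef

theorem not {P : (ι → ℝ) → Prop} (h : IsDef L {x | P x}) : IsDef L {x | ¬ P x} :=
  Set.Definable.compl h

theorem and {P Q : (ι → ℝ) → Prop} (hP : IsDef L {x | P x}) (hQ : IsDef L {x | Q x}) :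
    IsDef L {x | P x ∧ Q x} :=
  Set.Definable.inter hP hQ

theorem or {P Q : (ι → ℝ) → Prop} (hP : IsDef L {x | P x}) (hQ : IsDef L {x | Q x}) :
    IsDef L {x | P x ∨ Q x} :=
  Set.Definable.union hP hQ

theorem imp {P Q : (ι → ℝ) → Prop} (hP : IsDef L {x | P x}) (hQ : IsDef L {x | Q x}) :
    IsDef L {x | P x → Q x} := by
  have := hP.not.or hQ
  convert this using 3
  exact imp_iff_not_or

/-- Substitution of variables. -/
theorem comp {A : Set (κ → ℝ)} (hA : IsDef L A) (σ : κ → ι) :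
    IsDef L {z : ι → ℝ | (fun k => z (σ k)) ∈ A} :=
  Set.Definable.preimage_comp σ hA

theorem const (p : Prop) : IsDef L {_x : ι → ℝ | p} := by
  by_cases h : p
  · simp only [h]
    exact Set.definable_univ
  · simp only [h]
    exact Set.definable_empty

theorem exists_vec [Finite ι] [Finite κ] {P : (ι → ℝ) → (κ → ℝ) → Prop}
    (h : IsDef L {z : ι ⊕ κ → ℝ | P (fun i => z (Sum.inl i)) (fun k => z (Sum.inr k))}) :
    IsDef L {x | ∃ y, P x y} := by
  have := Set.Definable.image_comp h (Sum.inl : ι → ι ⊕ κ)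
  refine (congrArg (IsDef L) ?_).mp this
  ext x
  constructor
  · rintro ⟨z, hz, rfl⟩
    exact ⟨_, hz⟩
  · rintro ⟨y, hy⟩
    exact ⟨Sum.elim x y, hy, rfl⟩

theorem forall_vec [Finite ι] [Finite κ] {P : (ι → ℝ) → (κ → ℝ) → Prop}
    (h : IsDef L {z : ι ⊕ κ → ℝ | P (fun i => z (Sum.inl i)) (fun k => z (Sum.inr k))}) :
    IsDef L {x | ∀ y, P x y} := by
  have := (exists_vec (P := fun x y => ¬ P x y) h.not).not
  simpa using this

theorem exists_real [Finite ι] {P : (ι → ℝ) → ℝ → Prop}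
    (h : IsDef L {z : Option ι → ℝ | P (fun i => z (some i)) (z none)}) :
    IsDef L {x | ∃ t, P x t} := by
  have := Set.Definable.image_comp h (some : ι → Option ι)
  refine (congrArg (IsDef L) ?_).mp this
  ext x
  constructor
  · rintro ⟨z, hz, rfl⟩
    exact ⟨_, hz⟩
  · rintro ⟨y, hy⟩
    exact ⟨fun o => o.elim y x, hy, rfl⟩

theorem forall_real [Finite ι] {P : (ι → ℝ) → ℝ → Prop}
    (h : IsDef L {z : Option ι → ℝ | P (fun i => z (some i)) (z none)}) :
    IsDef L {x | ∀ t, P x t} := by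
  have := (exists_real (P := fun x y => ¬ P x y) h.not).not
  simpa using this

theorem forall_fin {α : Type*} [Finite α] {P : α → (ι → ℝ) → Prop}
    (h : ∀ a, IsDef L {x | P a x}) : IsDef L {x | ∀ a, P a x} := by
  have := Set.definable_iInter_of_finite (A := (univ : Set ℝ)) (L := L) h
  refine (congrArg (IsDef L) ?_).mp this
  ext x; simp

theorem exists_fin {α : Type*} [Finite α] {P : α → (ι → ℝ) → Prop}
    (h : ∀ a, IsDef L {x | P a x}) : IsDef L {x | ∃ a, P a x} := by
  have := Set.definable_iUnion_of_finite (A := (univ : Set ℝ)) (L := L) h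
  refine (congrArg (IsDef L) ?_).mp this
  ext x; simp

theorem eq_const (i : ι) (c : ℝ) : IsDef L {z : ι → ℝ | z i = c} := by
  have := Set.Definable.singleton (L := L) c
  have h2 : (univ : Set ℝ).Definable L {z : Fin 1 → ℝ | z 0 = c} :=
    Set.Definable.mono this (subset_univ _)
  exact comp (L := L) h2 (fun _ => i)

theorem eq_var (i j : ι) : IsDef L {z : ι → ℝ | z i = z j} := by
  have := Set.Definable.diagonal (L := L) (univ : Set ℝ)
  have h2 : (univ : Set ℝ).Definable L {z : Fin 2 → ℝ | z 0 = z 1} := by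
    refine (congrArg _ ?_).mp this
    ext z; simp
  exact comp (L := L) h2 ![i, j]

end IsDef

/-- Freezing some of the variables at real values. -/
theorem IsDef.fix [Finite ι] [Finite κ] {P : (ι → ℝ) → (κ → ℝ) → Prop}
    (h : IsDef L {z : ι ⊕ κ → ℝ | P (fun i => z (Sum.inl i)) (fun k => z (Sum.inr k))})
    (c : ι → ℝ) : IsDef L {y | P c y} := by
  have h1 : IsDef L {y : κ → ℝ | ∃ x : ι → ℝ, (∀ i, x i = c i) ∧ P x y} := by
    refine IsDef.exists_vec ((IsDef.forall_fin fun i => ?_).and ?_)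
    · exact IsDef.eq_const _ _
    · exact h.comp (Sum.elim Sum.inr Sum.inl)
  refine (congrArg (IsDef L) ?_).mp h1
  ext y
  constructor
  · rintro ⟨x, hx, hP⟩
    rwa [funext hx] at hP
  · exact fun hP => ⟨c, fun _ => rfl, hP⟩

/-- Freezing all variables but one at real values. -/
theorem IsDef.fix_real [Finite ι] {P : (ι → ℝ) → ℝ → Prop}
    (h : IsDef L {z : Option ι → ℝ | P (fun i => z (some i)) (z none)})
    (c : ι → ℝ) : (univ : Set ℝ).Definable₁ L {t | P c t} := by
  have h1 : IsDef L {z : ι ⊕ Fin 1 → ℝ | P (fun i => z (Sum.inl i)) (z (Sum.inr 0))} :=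
    h.comp (fun o => o.elim (Sum.inr 0) Sum.inl)
  exact IsDef.fix (P := fun x y => P x (y 0)) h1 c

namespace IsOMinimal

theorem lt_var (hL : IsOMinimal L) (i j : ι) : IsDef L {z : ι → ℝ | z i < z j} := by
  have h2 : (univ : Set ℝ).Definable L {z : Fin 2 → ℝ | z 0 < z 1} := hL.definable_lt
  exact IsDef.comp (L := L) h2 ![i, j]

theorem le_var (hL : IsOMinimal L) (i j : ι) : IsDef L {z : ι → ℝ | z i ≤ z j} := by
  simpa using (hL.lt_var j i).not

theorem lt_const (hL : IsOMinimal L) [Finite ι] (i : ι) (c : ℝ) :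
    IsDef L {z : ι → ℝ | z i < c} := by
  have h : IsDef L {z : ι → ℝ | ∃ t, t = c ∧ z i < t} :=
    IsDef.exists_real ((IsDef.eq_const _ _).and (hL.lt_var _ _))
  simpa using h

theorem const_lt (hL : IsOMinimal L) [Finite ι] (i : ι) (c : ℝ) :
    IsDef L {z : ι → ℝ | c < z i} := by
  have h : IsDef L {z : ι → ℝ | ∃ t, t = c ∧ t < z i} :=
    IsDef.exists_real ((IsDef.eq_const _ _).and (hL.lt_var _ _))
  simpa using h

end IsOMinimal

/-- Neighbourhoods in `ℝ^ι` are described by open boxes. -/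
theorem eventually_nhds_iff_box [Finite ι] {P : (ι → ℝ) → Prop} {x : ι → ℝ} :
    (∀ᶠ y in 𝓝 x, P y) ↔ ∃ a b : ι → ℝ, (∀ i, a i < x i ∧ x i < b i) ∧
      ∀ y, (∀ i, a i < y i ∧ y i < b i) → P y := by
  constructor
  · intro h
    rw [nhds_pi] at h
    obtain ⟨I, u, hu1, hu2⟩ := Filter.mem_pi'.mp h
    choose a b hab hsub using fun i => mem_nhds_iff_exists_Ioo_subset.mp (hu1 i)
    exact ⟨a, b, hab, fun y hy => hu2 fun i _ => hsub i (hy i)⟩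
  · rintro ⟨a, b, hab, h⟩
    have : ∀ᶠ y in 𝓝 x, ∀ i, a i < y i ∧ y i < b i := by
      rw [eventually_all]
      intro i
      exact ((continuous_apply i).tendsto x).eventually (Ioo_mem_nhds (hab i).1 (hab i).2)
    exact this.mono h

namespace IsDef

/-- Definability is preserved by the quantifier "for all `y` near the point `z ∘ σ`". -/
theorem eventually_nhds (hL : IsOMinimal L) [Finite ι] [Finite κ] (σ : ι → κ)
    {P : (κ → ℝ) → (ι → ℝ) → Prop}
    (h : IsDef L {z : κ ⊕ ι → ℝ | P (fun i => z (Sum.inl i)) (fun k => z (Sum.inr k))}) :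
    IsDef L {z | ∀ᶠ y in 𝓝 (fun i => z (σ i)), P z y} := by
  simp only [eventually_nhds_iff_box]
  refine exists_vec (exists_vec ((forall_fin fun i => ?_).and (forall_vec (imp ?_ ?_))))
  · exact (hL.lt_var _ _).and (hL.lt_var _ _)
  · exact forall_fin fun i => (hL.lt_var _ _).and (hL.lt_var _ _)
  · exact h.comp (Sum.elim (fun k => Sum.inl (Sum.inl (Sum.inl k))) Sum.inr)

theorem _root_.isDef_interior (hL : IsOMinimal L) [Finite ι] {A : Set (ι → ℝ)} (hA : IsDef L A) :
    IsDef L (interior A) := by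
  have := eventually_nhds hL (id : ι → ι) (P := fun _ y => y ∈ A) (hA.comp Sum.inr)
  refine (congrArg (IsDef L) ?_).mp this
  ext x
  exact mem_interior_iff_mem_nhds.symm

theorem _root_.isDef_frontier (hL : IsOMinimal L) [Finite ι] {A : Set (ι → ℝ)} (hA : IsDef L A) :
    IsDef L (frontier A) := by
  have h := ((isDef_interior hL hA).or (isDef_interior hL (Set.Definable.compl hA))).not
  refine (congrArg (IsDef L) ?_).mp h
  ext x
  rw [frontier_eq_closure_inter_closure, closure_compl, ← compl_compl (closure A),
    ← interior_compl]
  simp only [mem_ofPred_eq, mem_inter_iff, mem_compl_iff]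
  tauto

end IsDef

end Definability

/-! ### Genericity by the Baire category theorem -/

section Genericity

variable {L : FirstOrder.Language.{u, v}} [L.Structure ℝ] {ι κ : Type}

namespace IsOMinimal

theorem finite_frontier (hL : IsOMinimal L) {D : Set ℝ} (hD : (univ : Set ℝ).Definable₁ L D) :
    (frontier D).Finite := by
  obtain ⟨C, hC, rfl, hI⟩ := hL.finite_union D hD
  have key : ∀ I ∈ C, (frontier I).Finite := by
    intro I hIC
    rcases hI I hIC with ⟨a, rfl⟩ | ⟨a, b, rfl⟩
    · exact (finite_singleton a).subset (isClosed_singleton.frontier_subset)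
    · have h1 : {t : ℝ | a < (t : EReal) ∧ (t : EReal) < b} =
          {t : ℝ | a < (t : EReal)} ∩ {t : ℝ | (t : EReal) < b} := rfl
      have h2 : (frontier {t : ℝ | a < (t : EReal)}).Finite := by
        induction a with
        | bot => simp
        | top => simp
        | coe a =>
          have : {t : ℝ | (a : EReal) < (t : EReal)} = Ioi a := by ext; simp
          rw [this, frontier_Ioi]
          exact finite_singleton a
      have h3 : (frontier {t : ℝ | (t : EReal) < b}).Finite := by
        induction b with
        | bot => simp
        | top => simp
        | coe a =>
          have : {t : ℝ | (t : EReal) < (a : EReal)} = Iio a := by ext; simp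
          rw [this, frontier_Iio]
          exact finite_singleton a
      rw [h1]
      refine (h2.union h3).subset ((frontier_inter_subset _ _).trans ?_)
      exact union_subset_union inter_subset_left inter_subset_right
  clear hD hI
  induction C, hC using Set.Finite.induction_on with
  | empty => simp
  | @insert a s _ _ ih =>
    rw [sUnion_insert]
    have h1 := key a (mem_insert _ _)
    have h2 := ih fun I hI => key I (mem_insert_of_mem _ hI)
    refine (h1.union h2).subset ((frontier_union_subset _ _).trans ?_)
    exact union_subset_union inter_subset_left inter_subset_right

theorem finite_of_interior_eq_empty (hL : IsOMinimal L) {D : Set ℝ}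
    (hD : (univ : Set ℝ).Definable₁ L D) (h : interior D = ∅) : D.Finite := by
  refine (hL.finite_frontier hD).subset fun x hx => ?_
  rw [frontier, h, sdiff_empty]
  exact subset_closure hx

theorem finite_of_no_interval (hL : IsOMinimal L) {D : Set ℝ}
    (hD : (univ : Set ℝ).Definable₁ L D) (h : ¬ ∃ a b, a < b ∧ ∀ t ∈ Ioo a b, t ∈ D) :
    D.Finite := by
  refine hL.finite_of_interior_eq_empty hD ?_
  by_contra hne
  obtain ⟨x, hx⟩ := nonempty_iff_ne_empty.mpr hne
  obtain ⟨a, b, hab, hs⟩ := mem_nhds_iff_exists_Ioo_subset.mp (mem_interior_iff_mem_nhds.mp hx)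
  exact h ⟨a, b, hab.1.trans hab.2, hs⟩

/-- Every interval contains a rational interval inside or outside a given definable subset
of the line. -/
theorem exists_rat_interval (hL : IsOMinimal L) {D : Set ℝ}
    (hD : (univ : Set ℝ).Definable₁ L D) {a b : ℝ} (hab : a < b) :
    ∃ p q : ℚ, a < p ∧ p < q ∧ q < b ∧
      ((∀ t ∈ Ioo (p : ℝ) q, t ∈ D) ∨ ∀ t ∈ Ioo (p : ℝ) q, t ∉ D) := by
  obtain ⟨x, hx, hxf⟩ := ((Ioo_infinite hab).sdiff (hL.finite_frontier hD)).nonempty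
  have key : ∀ E : Set ℝ, x ∈ interior E →
      ∃ p q : ℚ, a < p ∧ p < q ∧ q < b ∧ ∀ t ∈ Ioo (p : ℝ) q, t ∈ E := by
    intro E hE
    have : E ∩ Ioo a b ∈ 𝓝 x :=
      inter_mem (mem_interior_iff_mem_nhds.mp hE) (Ioo_mem_nhds hx.1 hx.2)
    obtain ⟨c, d, hcd, hs⟩ := mem_nhds_iff_exists_Ioo_subset.mp this
    obtain ⟨p, hp1, hp2⟩ := exists_rat_btwn (max_lt hcd.1 hx.1)
    obtain ⟨q, hq1, hq2⟩ := exists_rat_btwn (lt_min hcd.2 hx.2)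
    refine ⟨p, q, (le_max_right _ _).trans_lt hp1, by exact_mod_cast hp2.trans hq1,
      hq2.trans_le (min_le_right _ _), fun t ht => (hs ⟨?_, ?_⟩).1⟩
    · exact (le_max_left _ _).trans_lt (hp1.trans ht.1)
    · exact ht.2.trans (hq2.trans_le (min_le_left _ _))
  by_cases hxD : x ∈ interior D
  · obtain ⟨p, q, h1, h2, h3, h4⟩ := key D hxD
    exact ⟨p, q, h1, h2, h3, Or.inl h4⟩
  · have : x ∈ interior Dᶜ := by
      rw [interior_compl]
      intro hc
      exact hxf ⟨hc, hxD⟩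
    obtain ⟨p, q, h1, h2, h3, h4⟩ := key _ this
    exact ⟨p, q, h1, h2, h3, Or.inr h4⟩

end IsOMinimal

/-- A countable definable cover of a nonempty open set has a member with an interior point there,
provided that frontiers of definable sets have empty interior: this is the Baire category
theorem. -/
theorem exists_interior_of_countable_cover [Finite ι] {α : Type*} [Countable α]
    {D : α → Set (ι → ℝ)} (hD : ∀ a, interior (frontier (D a)) = ∅)
    {U : Set (ι → ℝ)} (hU : IsOpen U)
    (hne : U.Nonempty) (hcov : ∀ x ∈ U, ∃ a, x ∈ D a) :
    ∃ a, ∃ V ⊆ U, IsOpen V ∧ V.Nonempty ∧ V ⊆ D a := by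
  have := Fintype.ofFinite ι
  have h1 : Dense (⋂ a, (frontier (D a))ᶜ) :=
    dense_iInter_of_isOpen (fun a => isClosed_frontier.isOpen_compl)
      fun a => interior_eq_empty_iff_dense_compl.mp (hD a)
  obtain ⟨x, hxU, hx⟩ := h1.inter_open_nonempty U hU hne
  obtain ⟨a, ha⟩ := hcov x hxU
  have hxa : x ∈ interior (D a) := by
    by_contra h
    exact mem_iInter.mp hx a ⟨subset_closure ha, h⟩
  exact ⟨a, U ∩ interior (D a), inter_subset_left, hU.inter isOpen_interior, ⟨x, hxU, hxa⟩,
    inter_subset_right.trans interior_subset⟩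

/-- An open subset of `ℝ^ι × ℝ` contains a product of an open set and an interval. -/
theorem exists_prod_subset_of_isOpen_option {U : Set (Option ι → ℝ)} (hU : IsOpen U)
    (hne : U.Nonempty) : ∃ V : Set (ι → ℝ), IsOpen V ∧ V.Nonempty ∧ ∃ a b : ℝ, a < b ∧
      ∀ z : Option ι → ℝ, (fun i => z (some i)) ∈ V → z none ∈ Ioo a b → z ∈ U := by
  obtain ⟨z, hz⟩ := hne
  let g : (ι → ℝ) × ℝ → (Option ι → ℝ) := fun p o => o.elim p.2 p.1
  have hg : Continuous g := by
    refine continuous_pi fun o => ?_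
    cases o with
    | none => exact continuous_snd
    | some i => exact (continuous_apply i).comp continuous_fst
  have hgz : ∀ z : Option ι → ℝ, g (fun i => z (some i), z none) = z := by
    intro z; ext o; cases o <;> rfl
  have h1 := isOpen_prod_iff.mp (hU.preimage hg) (fun i => z (some i)) (z none)
    (by rw [mem_preimage, hgz]; exact hz)
  obtain ⟨V, W, hV, hW, hzV, hzW, hVW⟩ := h1
  obtain ⟨a, b, hab, hs⟩ := mem_nhds_iff_exists_Ioo_subset.mp (hW.mem_nhds hzW)
  refine ⟨V, hV, ⟨_, hzV⟩, a, b, hab.1.trans hab.2, fun y hy1 hy2 => ?_⟩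
  have := hVW (show (fun i => y (some i), y none) ∈ V ×ˢ W from ⟨hy1, hs hy2⟩)
  rwa [mem_preimage, hgz] at this

theorem isOpen_option_prod {V : Set (ι → ℝ)} (hV : IsOpen V) (a b : ℝ) :
    IsOpen {z : Option ι → ℝ | (fun i => z (some i)) ∈ V ∧ z none ∈ Ioo a b} :=
  (hV.preimage (by fun_prop : Continuous fun (z : Option ι → ℝ) i => z (some i))).inter
    (isOpen_Ioo.preimage (continuous_apply _))

/-- The frontier of a definable set has empty interior. The induction on the number of coordinates
adds one coordinate at a time: over each point of the base some rational interval lies inside or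
outside the fibre, and the Baire category theorem makes the choice of the interval constant on an
open set. -/
theorem IsDef.interior_frontier_eq_empty (hL : IsOMinimal L) [Finite ι] :
    ∀ D : Set (ι → ℝ), IsDef L D → interior (frontier D) = ∅ := by
  refine Finite.induction_empty_option
    (P := fun ι => ∀ D : Set (ι → ℝ), IsDef L D → interior (frontier D) = ∅) ?_ ?_ ?_ ι
  · intro α β e h D hD
    let Φ : (α → ℝ) ≃ₜ (β → ℝ) := Homeomorph.piCongrLeft (Y := fun _ => ℝ) e
    have hΦ : ∀ x i, Φ x (e i) = x i := fun x i =>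
      Equiv.piCongrLeft_apply_apply (P := fun _ => ℝ) e x i
    have hD' : IsDef L (Φ ⁻¹' D) := by
      have := hD.comp (ι := α) e.symm
      refine (congrArg (IsDef L) ?_).mp this
      ext x
      have : Φ x = fun k => x (e.symm k) := by
        ext k
        rw [← hΦ x (e.symm k), e.apply_symm_apply]
      rw [mem_preimage, this]
      rfl
    have h2 := h _ hD'
    rw [← Φ.preimage_frontier, ← Φ.preimage_interior, preimage_eq_empty_iff] at h2
    simpa using h2
  · intro D _
    simp
  · intro α _ ih D hD
    by_contra hne
    obtain ⟨V, hV, hVne, a, b, hab, hsub⟩ := exists_prod_subset_of_isOpen_option isOpen_interior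
      (nonempty_iff_ne_empty.mpr hne)
    let g : (α → ℝ) → ℝ → (Option α → ℝ) := fun x t o => o.elim t x
    have hgz : ∀ z : Option α → ℝ, g (fun i => z (some i)) (z none) = z := by
      intro z; ext o; cases o <;> rfl
    have hDg : IsDef L {z : Option α → ℝ | g (fun i => z (some i)) (z none) ∈ D} := by
      simp only [hgz]; exact hD
    let E : ℚ × ℚ × Bool → Set (α → ℝ) := fun p =>
      {x | ((a < p.1 ∧ p.1 < p.2.1) ∧ p.2.1 < b) ∧
        ∀ t : ℝ, (p.1 : ℝ) < t ∧ t < p.2.1 → (g x t ∈ D ↔ p.2.2 = true)}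
    have hE : ∀ p, IsDef L (E p) := by
      rintro ⟨p, q, s⟩
      refine (IsDef.const _).and (IsDef.forall_real (((hL.const_lt _ _).and
        (hL.lt_const _ _)).imp ?_))
      cases s
      · simpa using hDg.not
      · simpa using hDg
    have hcov : ∀ x ∈ V, ∃ p, x ∈ E p := by
      intro x hx
      obtain ⟨p, q, h1, h2, h3, h4⟩ :=
        hL.exists_rat_interval (IsDef.fix_real (P := fun x t => g x t ∈ D) hDg x) hab
      rcases h4 with h4 | h4
      · exact ⟨(p, q, true), ⟨⟨h1, h2⟩, h3⟩, fun t ht => by simpa using h4 t ht⟩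
      · exact ⟨(p, q, false), ⟨⟨h1, h2⟩, h3⟩, fun t ht => by simpa using h4 t ht⟩
    obtain ⟨⟨p, q, s⟩, W, hWV, hW, ⟨w, hw⟩, hWE⟩ :=
      exists_interior_of_countable_cover (fun p => ih _ (hE p)) hV hVne hcov
    obtain ⟨⟨⟨h1, h2⟩, h3⟩, -⟩ := hWE hw
    simp only at h1 h2 h3
    have hpq : (p : ℝ) < q := by exact_mod_cast h2
    have hO := isOpen_option_prod hW (p : ℝ) q
    set O := {z : Option α → ℝ | (fun i => z (some i)) ∈ W ∧ z none ∈ Ioo (p : ℝ) q} with hOdef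
    have hz : g w ((p + q) / 2) ∈ O := ⟨hw, by constructor <;> simp [g] <;> linarith⟩
    have hzf : g w ((p + q) / 2) ∈ frontier D := by
      refine interior_subset (hsub _ (hWV hw) ⟨?_, ?_⟩) <;> simp [g] <;> linarith
    have hOD : ∀ z ∈ O, (z ∈ D ↔ s = true) := by
      rintro z ⟨hz1, hz2⟩
      have := (hWE hz1).2 (z none) hz2
      rwa [hgz] at this
    rw [frontier_eq_closure_inter_closure] at hzf
    obtain ⟨y, hyO, hyD⟩ := mem_closure_iff.mp hzf.1 O hO hz
    obtain ⟨y', hyO', hyD'⟩ := mem_closure_iff.mp hzf.2 O hO hz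
    exact hyD' ((hOD y' hyO').mpr ((hOD y hyO).mp hyD))

/-- Every nonempty open set contains a nonempty open set inside or outside a given definable set. -/
theorem IsDef.exists_open_subset_or_disjoint (hL : IsOMinimal L) [Finite ι] {D : Set (ι → ℝ)}
    (hD : IsDef L D) {U : Set (ι → ℝ)} (hU : IsOpen U) (hne : U.Nonempty) :
    ∃ V ⊆ U, IsOpen V ∧ V.Nonempty ∧ (V ⊆ D ∨ ∀ x ∈ V, x ∉ D) := by
  obtain ⟨s, V, h1, h2, h3, h4⟩ := exists_interior_of_countable_cover
    (D := fun s : Bool => if s then D else Dᶜ) (U := U)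
    (fun s => by
      cases s
      · simpa [frontier_compl] using hD.interior_frontier_eq_empty hL D
      · simpa using hD.interior_frontier_eq_empty hL D) hU hne
    (fun x _ => by
      by_cases hx : x ∈ D
      · exact ⟨true, by simpa⟩
      · exact ⟨false, by simpa⟩)
  refine ⟨V, h1, h2, h3, ?_⟩
  cases s
  · exact Or.inr h4
  · exact Or.inl h4

theorem exists_open_subset_of_countable_cover (hL : IsOMinimal L) [Finite ι] {α : Type*}
    [Countable α] {D : α → Set (ι → ℝ)} (hD : ∀ a, IsDef L (D a)) {U : Set (ι → ℝ)}
    (hU : IsOpen U) (hne : U.Nonempty) (hcov : ∀ x ∈ U, ∃ a, x ∈ D a) :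
    ∃ a, ∃ V ⊆ U, IsOpen V ∧ V.Nonempty ∧ V ⊆ D a :=
  exists_interior_of_countable_cover (fun a => (hD a).interior_frontier_eq_empty hL _) hU hne hcov

/-- A definable set whose fibres over an open set all contain intervals contains a box. -/
theorem exists_box_of_fibres_contain_intervals (hL : IsOMinimal L) [Finite ι]
    {A : (ι → ℝ) → ℝ → Prop}
    (hA : IsDef L {z : Option ι → ℝ | A (fun i => z (some i)) (z none)})
    {U : Set (ι → ℝ)} (hU : IsOpen U) (hne : U.Nonempty)
    (h : ∀ x ∈ U, ∃ a b, a < b ∧ ∀ t ∈ Ioo a b, A x t) :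
    ∃ V ⊆ U, IsOpen V ∧ V.Nonempty ∧ ∃ a b, a < b ∧ ∀ x ∈ V, ∀ t ∈ Ioo a b, A x t := by
  obtain ⟨⟨p, q⟩, V, h1, h2, ⟨w, hw⟩, h4⟩ := exists_open_subset_of_countable_cover hL
    (D := fun p : ℚ × ℚ => {x | p.1 < p.2 ∧ ∀ t : ℝ, (p.1 : ℝ) < t ∧ t < p.2 → A x t})
    (fun p => (IsDef.const _).and (IsDef.forall_real (((hL.const_lt _ _).and
        (hL.lt_const _ _)).imp hA))) hU hne (fun x hx => by
      obtain ⟨a, b, hab, h⟩ := h x hx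
      obtain ⟨p, hp1, hp2⟩ := exists_rat_btwn hab
      obtain ⟨q, hq1, hq2⟩ := exists_rat_btwn hp2
      exact ⟨(p, q), by exact_mod_cast hq1, fun t ht => h t ⟨hp1.trans ht.1, ht.2.trans hq2⟩⟩)
  exact ⟨V, h1, h2, ⟨w, hw⟩, p, q, by exact_mod_cast (h4 hw).1, fun x hx t ht => (h4 hx).2 t ht⟩

/-- Finitely many properties, each of which holds on some open subset of every nonempty open set and
is inherited by open subsets, hold simultaneously. -/
theorem exists_open_forall_of_forall_exists_open {X α : Type*} [TopologicalSpace X]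
    {Q : α → Set X → Prop} (hmono : ∀ a V W, V ⊆ W → Q a W → Q a V) (s : Finset α)
    {U : Set X} (hU : IsOpen U) (hne : U.Nonempty)
    (h : ∀ a ∈ s, ∀ V ⊆ U, IsOpen V → V.Nonempty → ∃ W ⊆ V, IsOpen W ∧ W.Nonempty ∧ Q a W) :
    ∃ V ⊆ U, IsOpen V ∧ V.Nonempty ∧ ∀ a ∈ s, Q a V := by
  classical
  induction s using Finset.induction_on with
  | empty => exact ⟨U, subset_rfl, hU, hne, by simp⟩
  | insert a s _ ih =>
    obtain ⟨V, hVU, hV, hVne, hVQ⟩ := ih fun b hb => h b (Finset.mem_insert_of_mem hb)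
    obtain ⟨W, hWV, hW, hWne, hWQ⟩ := h a (Finset.mem_insert_self _ _) V hVU hV hVne
    refine ⟨W, hWV.trans hVU, hW, hWne, fun b hb => ?_⟩
    rcases Finset.mem_insert.mp hb with rfl | hb
    · exact hWQ
    · exact hmono _ _ _ hWV (hVQ b hb)

end Genericity

/-! ### Definable functions and generic continuity -/

section DefinableFunctions

variable {L : FirstOrder.Language.{u, v}} [L.Structure ℝ] {ι κ : Type}

/-- The graph of `f` over `S` is definable; the values of `f` outside `S` play no role. -/
def IsDefFun (L : FirstOrder.Language.{u, v}) [L.Structure ℝ] {ι : Type} (S : Set (ι → ℝ))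
    (f : (ι → ℝ) → ℝ) : Prop :=
  IsDef L {z : Option ι → ℝ | (fun i => z (some i)) ∈ S ∧ f (fun i => z (some i)) = z none}

theorem IsDefFun.subst [Finite κ] {S : Set (ι → ℝ)} {f : (ι → ℝ) → ℝ} (hf : IsDefFun L S f)
    (σ : ι → κ) {P : (κ → ℝ) → ℝ → Prop}
    (hP : IsDef L {z : Option κ → ℝ | P (fun i => z (some i)) (z none)}) :
    IsDef L {w : κ → ℝ | (fun i => w (σ i)) ∈ S ∧ P w (f fun i => w (σ i))} := by
  have h : IsDef L {w : κ → ℝ | ∃ t, ((fun i => w (σ i)) ∈ S ∧ f (fun i => w (σ i)) = t) ∧ P w t} :=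
    IsDef.exists_real ((IsDef.comp hf (Option.map σ)).and hP)
  refine (congrArg (IsDef L) ?_).mp h
  ext w
  constructor
  · rintro ⟨t, ⟨h1, rfl⟩, h2⟩
    exact ⟨h1, h2⟩
  · rintro ⟨h1, h2⟩
    exact ⟨_, ⟨h1, rfl⟩, h2⟩

theorem IsDefFun.isDef_domain [Finite ι] {S : Set (ι → ℝ)} {f : (ι → ℝ) → ℝ}
    (hf : IsDefFun L S f) : IsDef L S := by
  have := hf.subst id (P := fun _ _ => True) (IsDef.const _)
  simp only [and_true] at this
  exact this

theorem IsDefFun.mono {S T : Set (ι → ℝ)} {f : (ι → ℝ) → ℝ} (hf : IsDefFun L S f)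
    (hT : IsDef L T) (hTS : T ⊆ S) : IsDefFun L T f := by
  have h : IsDef L {z : Option ι → ℝ | ((fun i => z (some i)) ∈ S ∧
      f (fun i => z (some i)) = z none) ∧ (fun i => z (some i)) ∈ T} :=
    IsDef.and hf (hT.comp some)
  refine (congrArg (IsDef L) ?_).mp h
  ext z
  exact ⟨fun h => ⟨h.2, h.1.2⟩, fun h => ⟨⟨hTS h.1, h.2⟩, h.1⟩⟩

/-- The set of interior points of continuity of a definable function is definable. -/
theorem IsDefFun.isDef_continuousAt (hL : IsOMinimal L) [Finite ι] {S : Set (ι → ℝ)}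
    {f : (ι → ℝ) → ℝ} (hf : IsDefFun L S f) :
    IsDef L {x | x ∈ interior S ∧ ContinuousAt f x} := by
  have h : IsDef L {x | x ∈ interior S ∧ x ∈ S ∧ ∀ a b, (a < f x ∧ f x < b) →
      ∀ᶠ y in 𝓝 (fun i => x i), y ∈ S ∧ (a < f y ∧ f y < b)} := by
    refine (isDef_interior hL hf.isDef_domain).and (hf.subst id (P := fun x t => ∀ a b,
      (a < t ∧ t < b) → ∀ᶠ y in 𝓝 (fun i => x i), y ∈ S ∧ (a < f y ∧ f y < b)) ?_)
    refine IsDef.forall_real (IsDef.forall_real (((hL.lt_var _ _).and (hL.lt_var _ _)).imp ?_))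
    refine IsDef.eventually_nhds hL (fun i => some (some (some i))) ?_
    exact hf.subst Sum.inr (P := fun z t => z (Sum.inl (some none)) < t ∧ t < z (Sum.inl none))
      ((hL.lt_var _ _).and (hL.lt_var _ _))
  refine (congrArg (IsDef L) ?_).mp h
  ext x
  constructor
  · rintro ⟨h1, h2, h3⟩
    refine ⟨h1, fun s hs => ?_⟩
    obtain ⟨a, b, hab, hs⟩ := mem_nhds_iff_exists_Ioo_subset.mp hs
    exact (h3 a b hab).mono fun y hy => hs hy.2
  · rintro ⟨h1, h2⟩
    refine ⟨h1, interior_subset h1, fun a b hab => ?_⟩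
    exact Filter.Eventually.and (mem_interior_iff_mem_nhds.mp h1)
      (h2.eventually (Ioo_mem_nhds hab.1 hab.2))

/-- A definable function is continuous on some open subset of every open subset of its domain:
points outside the frontiers of the countably many sets `{f < r}`, `{r < f}` with `r` rational are
points of continuity, and they are dense. -/
theorem IsDefFun.exists_open_continuousAt (hL : IsOMinimal L) [Finite ι] {S U : Set (ι → ℝ)}
    {f : (ι → ℝ) → ℝ} (hf : IsDefFun L S f) (hU : IsOpen U) (hne : U.Nonempty) (hUS : U ⊆ S) :
    ∃ V ⊆ U, IsOpen V ∧ V.Nonempty ∧ ∀ x ∈ V, ContinuousAt f x := by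
  obtain ⟨V, hVU, hV, hVne, hV'⟩ :=
    (hf.isDef_continuousAt hL).exists_open_subset_or_disjoint hL hU hne
  refine ⟨V, hVU, hV, hVne, ?_⟩
  rcases hV' with hV' | hV'
  · exact fun x hx => (hV' hx).2
  exfalso
  have := Fintype.ofFinite ι
  let D : ℚ → Set (ι → ℝ) := fun r => {x | x ∈ S ∧ f x < r}
  let E : ℚ → Set (ι → ℝ) := fun r => {x | x ∈ S ∧ r < f x}
  have hD : ∀ r, IsDef L (D r) := fun r =>
    hf.subst id (P := fun _ t => t < r) (hL.lt_const _ _)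
  have hE : ∀ r, IsDef L (E r) := fun r =>
    hf.subst id (P := fun _ t => r < t) (hL.const_lt _ _)
  have h1 : Dense (⋂ r, (frontier (D r))ᶜ) :=
    dense_iInter_of_isOpen (fun a => isClosed_frontier.isOpen_compl)
      fun a => interior_eq_empty_iff_dense_compl.mp ((hD a).interior_frontier_eq_empty hL _)
  have h2 : Dense (⋂ r, (frontier (E r))ᶜ) :=
    dense_iInter_of_isOpen (fun a => isClosed_frontier.isOpen_compl)
      fun a => interior_eq_empty_iff_dense_compl.mp ((hE a).interior_frontier_eq_empty hL _)
  have h3 : Dense ((⋂ r, (frontier (D r))ᶜ) ∩ ⋂ r, (frontier (E r))ᶜ) :=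
    h1.inter_of_Gδ (IsGδ.iInter_of_isOpen fun a => isClosed_frontier.isOpen_compl)
      (IsGδ.iInter_of_isOpen fun a => isClosed_frontier.isOpen_compl) h2
  obtain ⟨x, hxV, hxD, hxE⟩ := h3.inter_open_nonempty V hV hVne
  refine hV' x hxV ⟨interior_maximal hUS hU (hVU hxV), fun s hs => ?_⟩
  obtain ⟨a, b, hab, hs⟩ := mem_nhds_iff_exists_Ioo_subset.mp hs
  obtain ⟨p, hp1, hp2⟩ := exists_rat_btwn hab.1
  obtain ⟨q, hq1, hq2⟩ := exists_rat_btwn hab.2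
  have hmem : ∀ {T : Set (ι → ℝ)}, x ∈ T → x ∉ frontier T → T ∈ 𝓝 x := fun hT hfr =>
    mem_interior_iff_mem_nhds.mp (by_contra fun hn => hfr ⟨subset_closure hT, hn⟩)
  have hxS := hUS (hVU hxV)
  have k1 := hmem (T := E p) ⟨hxS, hp2⟩ (mem_iInter.mp hxE p)
  have k2 := hmem (T := D q) ⟨hxS, hq1⟩ (mem_iInter.mp hxD q)
  change ∀ᶠ y in 𝓝 x, f y ∈ s
  filter_upwards [k1, k2] with y hy1 hy2
  exact hs ⟨hp1.trans hy1.2, hy2.2.trans hq2⟩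

end DefinableFunctions

/-! ### Finite sets and families of finite sets -/

section FiniteSets

/-- A finite set of reals has at least `k + 1` elements below `t` if and only if some element below
`t` has at least `k` elements below it. This turns cardinalities into first-order conditions. -/
theorem succ_le_ncard_inter_Iio {s : Set ℝ} (hs : s.Finite) {k : ℕ} {t : ℝ} :
    k + 1 ≤ (s ∩ Iio t).ncard ↔ ∃ u, (u ∈ s ∧ u < t) ∧ k ≤ (s ∩ Iio u).ncard := by
  have hfin : ∀ t, (s ∩ Iio t).Finite := fun t => hs.subset inter_subset_left
  constructor
  · intro h
    have hne : (s ∩ Iio t).Nonempty := by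
      rw [← ncard_pos (hfin t)]; omega
    obtain ⟨u, hu, hmax⟩ := exists_max_image _ id (hfin t) hne
    refine ⟨u, hu, ?_⟩
    have : s ∩ Iio t ⊆ insert u (s ∩ Iio u) := by
      intro v hv
      rcases (hmax v hv).lt_or_eq with h | h
      · exact Or.inr ⟨hv.1, h⟩
      · exact Or.inl h
    have h1 := ncard_le_ncard this ((hfin u).insert u)
    have h2 := ncard_insert_le u (s ∩ Iio u)
    omega
  · rintro ⟨u, ⟨hu, hut⟩, hk⟩
    have : insert u (s ∩ Iio u) ⊆ s ∩ Iio t :=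
      insert_subset ⟨hu, hut⟩ fun v hv => ⟨hv.1, lt_trans hv.2 hut⟩
    have h1 := ncard_le_ncard this (hfin t)
    rw [ncard_insert_of_notMem (fun h => lt_irrefl u h.2) (hfin u)] at h1
    omega

theorem le_ncard_iff_exists_Iio {s : Set ℝ} (hs : s.Finite) {k : ℕ} :
    k ≤ s.ncard ↔ ∃ t, k ≤ (s ∩ Iio t).ncard := by
  constructor
  · intro h
    obtain ⟨M, hM⟩ := hs.bddAbove
    refine ⟨M + 1, ?_⟩
    rwa [inter_eq_left.mpr]
    exact fun x hx => (hM hx).trans_lt (lt_add_one M)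
  · rintro ⟨t, ht⟩
    exact ht.trans (ncard_le_ncard inter_subset_left hs)

theorem exists_mem_ncard_inter_Iio_eq {s : Set ℝ} (hs : s.Finite) {k : ℕ} (hk : k < s.ncard) :
    ∃ t ∈ s, (s ∩ Iio t).ncard = k := by
  obtain ⟨M, hM⟩ := (le_ncard_iff_exists_Iio hs (k := k + 1)).mp hk
  obtain ⟨u, ⟨hu, -⟩, hku⟩ := (succ_le_ncard_inter_Iio hs).mp hM
  obtain ⟨v, ⟨hv, hkv⟩, hmin⟩ := exists_min_image {v ∈ s | k ≤ (s ∩ Iio v).ncard} id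
    (hs.subset (sep_subset _ _)) ⟨u, hu, hku⟩
  refine ⟨v, hv, le_antisymm ?_ hkv⟩
  by_contra! hlt
  obtain ⟨w, ⟨hw, hwv⟩, hkw⟩ := (succ_le_ncard_inter_Iio hs).mp hlt
  exact absurd (hmin w ⟨hw, hkw⟩) (not_le.mpr hwv)

open Classical in
/-- The element of the set `s` of reals with exactly `k` elements of `s` below it, and `0` if there
is none. -/
noncomputable def nthElt (s : Set ℝ) (k : ℕ) : ℝ :=
  if h : ∃ t ∈ s, (s ∩ Iio t).ncard = k then h.choose else 0

theorem nthElt_spec {s : Set ℝ} (hs : s.Finite) {k : ℕ} (hk : k < s.ncard) :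
    nthElt s k ∈ s ∧ (s ∩ Iio (nthElt s k)).ncard = k := by
  have h := exists_mem_ncard_inter_Iio_eq hs hk
  rw [nthElt, dif_pos h]
  exact h.choose_spec

theorem ncard_inter_Iio_lt {s : Set ℝ} (hs : s.Finite) {t : ℝ} (ht : t ∈ s) :
    (s ∩ Iio t).ncard < s.ncard :=
  ncard_lt_ncard ⟨inter_subset_left, fun h => lt_irrefl t (h ht).2⟩ hs

theorem nthElt_ncard_inter_Iio {s : Set ℝ} (hs : s.Finite) {t : ℝ} (ht : t ∈ s) :
    nthElt s (s ∩ Iio t).ncard = t := by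
  obtain ⟨h1, h2⟩ := nthElt_spec hs (ncard_inter_Iio_lt hs ht)
  have key : ∀ u ∈ s, ∀ v ∈ s, u < v → (s ∩ Iio u).ncard < (s ∩ Iio v).ncard :=
    fun u hu v _ huv => (succ_le_ncard_inter_Iio hs).mpr ⟨u, ⟨hu, huv⟩, le_rfl⟩
  rcases lt_trichotomy (nthElt s (s ∩ Iio t).ncard) t with h | h | h
  · exact absurd (key _ h1 _ ht h) (by omega)
  · exact h
  · exact absurd (key _ ht _ h1 h) (by omega)

theorem nthElt_eq_iff {s : Set ℝ} (hs : s.Finite) {k : ℕ} (hk : k < s.ncard) {t : ℝ} :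
    nthElt s k = t ↔ t ∈ s ∧ (s ∩ Iio t).ncard = k := by
  constructor
  · rintro rfl
    exact nthElt_spec hs hk
  · rintro ⟨h1, rfl⟩
    exact nthElt_ncard_inter_Iio hs h1

end FiniteSets

section FiniteFamilies

variable {L : FirstOrder.Language.{u, v}} [L.Structure ℝ] {ι κ : Type}

/-- The family of subsets `A x` of the line, with `x` ranging over `ℝ^ι`, is definable. -/
def IsDefFam (L : FirstOrder.Language.{u, v}) [L.Structure ℝ] {ι : Type}
    (A : (ι → ℝ) → Set ℝ) : Prop :=
  IsDef L {z : Option ι → ℝ | z none ∈ A (fun i => z (some i))}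

theorem IsDefFam.mem {A : (ι → ℝ) → Set ℝ} (hA : IsDefFam L A) (σ : ι → κ) (j : κ) :
    IsDef L {z : κ → ℝ | z j ∈ A (fun i => z (σ i))} :=
  IsDef.comp hA (fun o => o.elim j σ)

theorem IsDefFam.le_ncard_inter_Iio (hL : IsOMinimal L) [Finite ι] {A : (ι → ℝ) → Set ℝ}
    (hA : IsDefFam L A) (hfin : ∀ x, (A x).Finite) (k : ℕ) :
    IsDef L {z : Option ι → ℝ | k ≤ (A (fun i => z (some i)) ∩ Iio (z none)).ncard} := by
  induction k with
  | zero => simpa using IsDef.const True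
  | succ k ih =>
    simp only [succ_le_ncard_inter_Iio (hfin _)]
    exact IsDef.exists_real (((hA.mem (fun i => some (some i)) none).and (hL.lt_var _ _)).and
      (ih.comp (fun o => o.elim none fun i => some (some i))))

theorem IsDefFam.le_ncard (hL : IsOMinimal L) [Finite ι] {A : (ι → ℝ) → Set ℝ}
    (hA : IsDefFam L A) (hfin : ∀ x, (A x).Finite) (k : ℕ) :
    IsDef L {x | k ≤ (A x).ncard} := by
  simp only [le_ncard_iff_exists_Iio (hfin _)]
  exact IsDef.exists_real (hA.le_ncard_inter_Iio hL hfin k)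

theorem IsDefFam.ncard_eq (hL : IsOMinimal L) [Finite ι] {A : (ι → ℝ) → Set ℝ}
    (hA : IsDefFam L A) (hfin : ∀ x, (A x).Finite) (k : ℕ) :
    IsDef L {x | (A x).ncard = k} := by
  refine (congrArg (IsDef L) ?_).mp
    ((hA.le_ncard hL hfin k).and (hA.le_ncard hL hfin (k + 1)).not)
  ext x
  change (k ≤ (A x).ncard ∧ ¬ k + 1 ≤ (A x).ncard) ↔ (A x).ncard = k
  omega

theorem IsDefFam.isDefFun_nthElt (hL : IsOMinimal L) [Finite ι] {A : (ι → ℝ) → Set ℝ}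
    (hA : IsDefFam L A) (hfin : ∀ x, (A x).Finite) {k m : ℕ} (hkm : k < m) :
    IsDefFun L {x | (A x).ncard = m} fun x => nthElt (A x) k := by
  have h := ((hA.ncard_eq hL hfin m).comp some).and (hA.and
    ((hA.le_ncard_inter_Iio hL hfin k).and (hA.le_ncard_inter_Iio hL hfin (k + 1)).not))
  refine (congrArg (IsDef L) ?_).mp h
  ext z
  refine and_congr_right fun h1 => ?_
  have h1' : (A fun i => z (some i)).ncard = m := h1
  rw [nthElt_eq_iff (hfin _) (h1' ▸ hkm)]
  refine and_congr_right fun _ => ?_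
  omega

/-- A first-order condition on the family `A` near `x` that makes the cardinality of the fibres
locally constant at `x`: lower and upper rays without points of `A x`, and intervals with a single
point of `A x`, remain so for all nearby fibres. -/
def IsGoodPoint (A : (ι → ℝ) → Set ℝ) (x : ι → ℝ) : Prop :=
  (∀ u, (∀ t, t ≤ u → t ∉ A x) → ∀ᶠ y in 𝓝 (fun i => x i), ∀ t, t ≤ u → t ∉ A y) ∧
  (∀ u, (∀ t, u ≤ t → t ∉ A x) → ∀ᶠ y in 𝓝 (fun i => x i), ∀ t, u ≤ t → t ∉ A y) ∧
  ∀ r t u, ((r < t ∧ t < u) ∧ t ∈ A x ∧ ∀ s, (r ≤ s ∧ s ≤ u) → s ∈ A x → s = t) →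
    ∀ᶠ y in 𝓝 (fun i => x i), ∃ t', (r < t' ∧ t' < u) ∧ t' ∈ A y ∧
      ∀ s, (r ≤ s ∧ s ≤ u) → s ∈ A y → s = t'

theorem IsDefFam.isDef_isGoodPoint (hL : IsOMinimal L) [Finite ι] {A : (ι → ℝ) → Set ℝ}
    (hA : IsDefFam L A) : IsDef L {x | IsGoodPoint A x} := by
  refine IsDef.and ?_ (IsDef.and ?_ ?_)
  · refine IsDef.forall_real (IsDef.imp ?_ ?_)
    · exact IsDef.forall_real ((hL.le_var _ _).imp (hA.mem _ _).not)
    · exact IsDef.eventually_nhds hL some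
        (IsDef.forall_real ((hL.le_var none (some (Sum.inl none))).imp (hA.mem _ _).not))
  · refine IsDef.forall_real (IsDef.imp ?_ ?_)
    · exact IsDef.forall_real ((hL.le_var _ _).imp (hA.mem _ _).not)
    · exact IsDef.eventually_nhds hL some
        (IsDef.forall_real ((hL.le_var (some (Sum.inl none)) none).imp (hA.mem _ _).not))
  · refine IsDef.forall_real (IsDef.forall_real (IsDef.forall_real (IsDef.imp ?_ ?_)))
    · exact ((hL.lt_var _ _).and (hL.lt_var _ _)).and ((hA.mem _ _).and
        (IsDef.forall_real (((hL.le_var _ _).and (hL.le_var _ _)).imp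
          ((hA.mem _ _).imp (IsDef.eq_var _ _)))))
    · refine IsDef.eventually_nhds hL (fun i => some (some (some i))) ?_
      refine IsDef.exists_real (IsDef.and ?_ ((hA.mem (fun i => some (Sum.inr i)) none).and
        (IsDef.forall_real (IsDef.imp ?_ ((hA.mem (fun i => some (some (Sum.inr i))) none).imp
          (IsDef.eq_var none (some none)))))))
      · exact (hL.lt_var (some (Sum.inl (some (some none)))) none).and
          (hL.lt_var none (some (Sum.inl none)))
      · exact (hL.le_var (some (some (Sum.inl (some (some none))))) none).and
          (hL.le_var none (some (some (Sum.inl none))))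

/-- The cardinality of the fibres is locally constant at good points. Separate the points of the
fibre by a chain of reals, and count from below. -/
theorem IsGoodPoint.eventually_ncard_eq {A : (ι → ℝ) → Set ℝ} (hfin : ∀ x, (A x).Finite)
    {x : ι → ℝ} (hx : IsGoodPoint A x) : ∀ᶠ y in 𝓝 x, (A y).ncard = (A x).ncard := by
  obtain ⟨hlow, hhigh, hmid⟩ := hx
  have key : ∀ k u, u ∉ A x → (A x ∩ Iio u).ncard = k →
      ∀ᶠ y in 𝓝 x, u ∉ A y ∧ (A y ∩ Iio u).ncard = k := by
    intro k
    induction k with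
    | zero =>
      intro u hu hk
      rw [ncard_eq_zero ((hfin x).subset inter_subset_left)] at hk
      refine (hlow u fun t ht htA => ?_).mono fun y hy => ⟨hy u le_rfl, ?_⟩
      · rcases ht.lt_or_eq with h | rfl
        · exact (Set.eq_empty_iff_forall_notMem.mp hk t) ⟨htA, h⟩
        · exact hu htA
      · rw [ncard_eq_zero ((hfin y).subset inter_subset_left)]
        exact Set.eq_empty_iff_forall_notMem.mpr fun t ht => hy t (le_of_lt ht.2) ht.1
    | succ k ih =>
      intro u hu hk
      have hne : (A x ∩ Iio u).Nonempty := by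
        rw [← ncard_pos ((hfin x).subset inter_subset_left)]; omega
      obtain ⟨t, ⟨htA, htu⟩, hmax⟩ := exists_max_image _ id
        ((hfin x).subset inter_subset_left) hne
      have hnh : (A x \ {t})ᶜ ∈ 𝓝 t :=
        ((hfin x).subset sdiff_subset).isClosed.isOpen_compl.mem_nhds (by simp)
      obtain ⟨a, b, hab, hs⟩ := mem_nhds_iff_exists_Ioo_subset.mp hnh
      obtain ⟨r, har, hrt⟩ := exists_between hab.1
      have hgap : ∀ s, r ≤ s → s < t → s ∉ A x := fun s h1 h2 h3 =>
        hs ⟨har.trans_le h1, h2.trans hab.2⟩ ⟨h3, h2.ne⟩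
      have hcard : (A x ∩ Iio r).ncard = k := by
        have h1 : A x ∩ Iio u = insert t (A x ∩ Iio r) := by
          ext s
          constructor
          · intro hs'
            rcases (hmax s hs').lt_or_eq with h | h
            · right
              refine ⟨hs'.1, ?_⟩
              by_contra hc
              exact hgap s (not_lt.mp hc) h hs'.1
            · exact Or.inl h
          · rintro (rfl | hs')
            · exact ⟨htA, htu⟩
            · exact ⟨hs'.1, hs'.2.trans (hrt.trans htu)⟩
        rw [h1, ncard_insert_of_notMem (fun h : t ∈ A x ∩ Iio r => lt_asymm hrt h.2)
          ((hfin x).subset inter_subset_left)] at hk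
        omega
      have h1 := ih r (hgap r le_rfl hrt) hcard
      have h2 := hmid r t u ⟨⟨hrt, htu⟩, htA, fun s hs1 hsA => by
        have hsu : s < u := lt_of_le_of_ne hs1.2 fun h => hu (h ▸ hsA)
        rcases (hmax s ⟨hsA, hsu⟩).lt_or_eq with h | h
        · exact absurd hsA (hgap s hs1.1 h)
        · exact h⟩
      filter_upwards [h1, h2] with y hy1 hy2
      obtain ⟨t', ⟨hrt', htu'⟩, htA', huniq⟩ := hy2
      refine ⟨fun huA => ?_, ?_⟩
      · exact htu'.ne (huniq u ⟨(hrt'.trans htu').le, le_rfl⟩ huA).symm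
      · have h1 : A y ∩ Iio u = insert t' (A y ∩ Iio r) := by
          ext s
          constructor
          · intro hs'
            by_cases hsr : s < r
            · exact Or.inr ⟨hs'.1, hsr⟩
            · exact Or.inl (huniq s ⟨not_lt.mp hsr, le_of_lt hs'.2⟩ hs'.1)
          · rintro (rfl | hs')
            · exact ⟨htA', htu'⟩
            · exact ⟨hs'.1, hs'.2.trans (hrt'.trans htu')⟩
        rw [h1, ncard_insert_of_notMem (fun h : t' ∈ A y ∩ Iio r => lt_asymm hrt' h.2)
          ((hfin y).subset inter_subset_left), hy1.2]
  obtain ⟨M, hM⟩ := (hfin x).bddAbove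
  have hM1 : ∀ t, M + 1 ≤ t → t ∉ A x := fun t ht htA => by linarith [hM htA]
  have hA : ∀ y, (∀ t, M + 1 ≤ t → t ∉ A y) → A y ∩ Iio (M + 1) = A y := fun y hy =>
    inter_eq_left.mpr fun t ht => not_le.mp fun h => hy t h ht
  have h1 := key _ (M + 1) (hM1 _ le_rfl) rfl
  filter_upwards [h1, hhigh (M + 1) hM1] with y hy1 hy2
  rw [← hA y hy2, hy1.2, hA x hM1]

/-- Good points are dense. -/
theorem IsDefFam.exists_isGoodPoint (hL : IsOMinimal L) [Finite ι] {A : (ι → ℝ) → Set ℝ}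
    (hA : IsDefFam L A) (hfin : ∀ x, (A x).Finite) {U : Set (ι → ℝ)} (hU : IsOpen U)
    (hne : U.Nonempty) : ∃ x ∈ U, IsGoodPoint A x := by
  obtain ⟨m, V, hVU, hV, hVne, hVm⟩ := exists_open_subset_of_countable_cover hL
    (fun m : ℕ => hA.ncard_eq hL hfin m) hU hne fun x _ => ⟨_, rfl⟩
  obtain ⟨W, hWV, hW, ⟨x, hx⟩, hWc⟩ := exists_open_forall_of_forall_exists_open
    (Q := fun k (W : Set (ι → ℝ)) => ∀ x ∈ W, ContinuousAt (fun x => nthElt (A x) k) x)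
    (fun k V W hVW h x hx => h x (hVW hx)) (Finset.range m) hV hVne
    fun k hk V' hV'V hV' hV'ne => (hA.isDefFun_nthElt hL hfin
      (Finset.mem_range.mp hk)).exists_open_continuousAt hL hV' hV'ne (hV'V.trans hVm)
  have hcont : ∀ k < m, ContinuousAt (fun x => nthElt (A x) k) x := fun k hk =>
    hWc k (Finset.mem_range.mpr hk) x hx
  have hmem : ∀ y ∈ W, ∀ t, t ∈ A y ↔ ∃ k : Fin m, nthElt (A y) k = t := by
    intro y hy t
    have hm : (A y).ncard = m := hVm (hWV hy)
    constructor
    · intro ht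
      exact ⟨⟨_, hm ▸ ncard_inter_Iio_lt (hfin y) ht⟩, nthElt_ncard_inter_Iio (hfin y) ht⟩
    · rintro ⟨k, rfl⟩
      exact (nthElt_spec (hfin y) (hm ▸ k.2)).1
  have hWx : ∀ᶠ y in 𝓝 x, y ∈ W := hW.mem_nhds hx
  refine ⟨x, hVU (hWV hx), ?_, ?_, ?_⟩
  · intro u hu
    have h1 : ∀ᶠ y in 𝓝 x, ∀ k : Fin m, u < nthElt (A y) k := by
      rw [eventually_all]
      intro k
      refine (hcont k k.2).eventually (lt_mem_nhds (not_le.mp fun h => ?_))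
      exact hu _ h ((hmem x hx _).mpr ⟨k, rfl⟩)
    filter_upwards [h1, hWx] with y hy hyW t ht htA
    obtain ⟨k, rfl⟩ := (hmem y hyW t).mp htA
    exact absurd (hy k) (not_lt.mpr ht)
  · intro u hu
    have h1 : ∀ᶠ y in 𝓝 x, ∀ k : Fin m, nthElt (A y) k < u := by
      rw [eventually_all]
      intro k
      refine (hcont k k.2).eventually (gt_mem_nhds (not_le.mp fun h => ?_))
      exact hu _ h ((hmem x hx _).mpr ⟨k, rfl⟩)
    filter_upwards [h1, hWx] with y hy hyW t ht htA
    obtain ⟨k, rfl⟩ := (hmem y hyW t).mp htA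
    exact absurd (hy k) (not_lt.mpr ht)
  · rintro r t u ⟨⟨hrt, htu⟩, htA, huniq⟩
    obtain ⟨k, rfl⟩ := (hmem x hx t).mp htA
    have h1 : ∀ᶠ y in 𝓝 x, nthElt (A y) k ∈ Ioo r u :=
      (hcont k k.2).eventually (Ioo_mem_nhds hrt htu)
    have h2 : ∀ᶠ y in 𝓝 x, ∀ j : Fin m, j ≠ k → nthElt (A y) j ∉ Icc r u := by
      rw [eventually_all]
      intro j
      by_cases hjk : j = k
      · simp [hjk]
      · have hj : nthElt (A x) j ∉ Icc r u := by
          intro hj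
          have h3 := huniq _ hj ((hmem x hx _).mpr ⟨j, rfl⟩)
          have hm : (A x).ncard = m := hVm (hWV hx)
          have h4 := (nthElt_spec (hfin x) (j.2.trans_eq hm.symm)).2
          rw [h3, (nthElt_spec (hfin x) (k.2.trans_eq hm.symm)).2] at h4
          exact hjk (Fin.ext h4.symm)
        exact ((hcont j j.2).eventually (isClosed_Icc.isOpen_compl.mem_nhds hj)).mono
          fun y hy _ => hy
    filter_upwards [h1, h2, hWx] with y hy1 hy2 hyW
    refine ⟨_, hy1, (hmem y hyW _).mpr ⟨k, rfl⟩, fun s hs hsA => ?_⟩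
    obtain ⟨j, rfl⟩ := (hmem y hyW s).mp hsA
    by_cases hjk : j = k
    · rw [hjk]
    · exact absurd hs (hy2 j hjk)

end FiniteFamilies

/-! ### Cells -/

section Cells

variable {L : FirstOrder.Language.{u, v}} [L.Structure ℝ] {n : ℕ}

/-- The set `C` projects homeomorphically to `ℝ^m` for some `m < n`, by forgetting coordinates. -/
def IsThin (C : Set (Fin n → ℝ)) : Prop :=
  ∃ m < n, ∃ σ : Fin m → Fin n, ∃ φ : (Fin m → ℝ) → (Fin n → ℝ),
    ContinuousOn φ ((fun z i => z (σ i)) '' C) ∧ ∀ z ∈ C, φ (fun i => z (σ i)) = z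

/-- A definable connected subset of `ℝ^n` that is either open or homeomorphic, by forgetting
coordinates, to a subset of a lower-dimensional space. This is all that is needed of the cells of
a cell decomposition. -/
structure IsCell (L : FirstOrder.Language.{u, v}) [L.Structure ℝ] (C : Set (Fin n → ℝ)) :
    Prop where
  isDef : IsDef L C
  isPreconnected : IsPreconnected C
  isOpen_or_isThin : IsOpen C ∨ IsThin C

theorem IsThin.mono {C D : Set (Fin n → ℝ)} (hD : IsThin D) (h : C ⊆ D) : IsThin C := by
  obtain ⟨m, hm, σ, φ, hφ, hφD⟩ := hD
  exact ⟨m, hm, σ, φ, hφ.mono (image_mono h), fun z hz => hφD z (h hz)⟩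

/-- The set `S` is the union of finitely many cells with the property `Q`. -/
def HasCells (L : FirstOrder.Language.{u, v}) [L.Structure ℝ] (Q : Set (Fin n → ℝ) → Prop)
    (S : Set (Fin n → ℝ)) : Prop :=
  ∃ 𝒞 : Set (Set (Fin n → ℝ)), 𝒞.Finite ∧ ⋃₀ 𝒞 = S ∧ ∀ C ∈ 𝒞, IsCell L C ∧ Q C

namespace HasCells

variable {Q R : Set (Fin n → ℝ) → Prop} {S T : Set (Fin n → ℝ)}

theorem of_isCell (h : IsCell L S) (hQ : Q S) : HasCells L Q S :=
  ⟨{S}, finite_singleton S, sUnion_singleton S, by rintro C rfl; exact ⟨h, hQ⟩⟩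

theorem empty : HasCells L Q (∅ : Set (Fin n → ℝ)) :=
  ⟨∅, finite_empty, sUnion_empty, by simp⟩

theorem union (hS : HasCells L Q S) (hT : HasCells L Q T) : HasCells L Q (S ∪ T) := by
  obtain ⟨𝒞, h1, rfl, h2⟩ := hS
  obtain ⟨𝒟, h3, rfl, h4⟩ := hT
  exact ⟨𝒞 ∪ 𝒟, h1.union h3, sUnion_union 𝒞 𝒟, fun C hC => hC.elim (h2 C) (h4 C)⟩

theorem biUnion {α : Type*} {s : Set α} (hs : s.Finite) {f : α → Set (Fin n → ℝ)}
    (h : ∀ a ∈ s, HasCells L Q (f a)) : HasCells L Q (⋃ a ∈ s, f a) := by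
  induction s, hs using Set.Finite.induction_on with
  | empty => simpa using empty
  | @insert a s _ _ ih =>
    rw [biUnion_insert]
    exact (h a (mem_insert _ _)).union (ih fun b hb => h b (mem_insert_of_mem _ hb))

theorem bind (hS : HasCells L Q S)
    (h : ∀ C, IsCell L C → Q C → C ⊆ S → HasCells L R C) : HasCells L R S := by
  obtain ⟨𝒞, h1, rfl, h2⟩ := hS
  have := biUnion (L := L) (Q := R) h1 (f := id)
    fun C hC => h C (h2 C hC).1 (h2 C hC).2 (subset_sUnion_of_mem hC)
  rwa [sUnion_eq_biUnion]

theorem imp (hS : HasCells L Q S) (h : ∀ C ⊆ S, IsCell L C → Q C → R C) : HasCells L R S :=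
  hS.bind fun C hC hQ hCS => of_isCell hC (h C hCS hC hQ)

/-- If every definable subset of `S` has a decomposition into cells with the hereditary property
`Q a`, for each `a` in a finite set, then it has one into cells with all these properties. -/
theorem forall_finset {α : Type*} (s : Finset α) {Q : α → Set (Fin n → ℝ) → Prop}
    (hmono : ∀ a C D, C ⊆ D → Q a D → Q a C)
    (hcell : ∀ T ⊆ S, IsDef L T → HasCells L (fun _ => True) T)
    (h : ∀ a ∈ s, ∀ T ⊆ S, IsDef L T → HasCells L (Q a) T) :
    ∀ T ⊆ S, IsDef L T → HasCells L (fun C => ∀ a ∈ s, Q a C) T := by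
  classical
  induction s using Finset.induction_on with
  | empty => simpa using hcell
  | insert a s _ ih =>
    intro T hTS hT
    refine (ih (fun b hb => h b (Finset.mem_insert_of_mem hb)) T hTS hT).bind
      fun C hC hQ hCT => ?_
    refine (h a (Finset.mem_insert_self _ _) C (hCT.trans hTS) hC.isDef).imp
      fun D hDC _ hQD b hb => ?_
    rcases Finset.mem_insert.mp hb with rfl | hb
    · exact hQD
    · exact hmono _ _ _ hDC (hQ b hb)

/-- Cell decompositions of the projection of a thin cell lift to the thin cell. -/
theorem of_projection {m : ℕ} {C : Set (Fin n → ℝ)} (hC : IsDef L C) (hthin : IsThin C)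
    {σ : Fin m → Fin n} {φ : (Fin m → ℝ) → (Fin n → ℝ)}
    (hφ : ContinuousOn φ ((fun z i => z (σ i)) '' C)) (hφC : ∀ z ∈ C, φ (fun i => z (σ i)) = z)
    {R : Set (Fin m → ℝ) → Prop}
    (h : HasCells L R ((fun z i => z (σ i)) '' C))
    (hRQ : ∀ D ⊆ (fun z i => z (σ i)) '' C, R D → Q {z | z ∈ C ∧ (fun i => z (σ i)) ∈ D}) :
    HasCells L Q C := by
  obtain ⟨𝒞, h1, h2, h3⟩ := h
  have hU : C = ⋃ D ∈ 𝒞, {z | z ∈ C ∧ (fun i => z (σ i)) ∈ D} := by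
    ext z
    simp only [mem_iUnion]
    constructor
    · intro hz
      have : (fun i => z (σ i)) ∈ ⋃₀ 𝒞 := h2 ▸ mem_image_of_mem _ hz
      obtain ⟨D, hD, hzD⟩ := this
      exact ⟨D, hD, hz, hzD⟩
    · rintro ⟨D, hD, hz, -⟩
      exact hz
  rw [hU]
  refine biUnion h1 fun D hD => ?_
  have hDC : D ⊆ (fun z i => z (σ i)) '' C := h2 ▸ subset_sUnion_of_mem hD
  have himg : {z | z ∈ C ∧ (fun i => z (σ i)) ∈ D} = φ '' D := by
    ext z
    constructor
    · rintro ⟨hz, hzD⟩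
      exact ⟨_, hzD, hφC z hz⟩
    · rintro ⟨w, hw, rfl⟩
      obtain ⟨z, hz, rfl⟩ := hDC hw
      simp only [hφC z hz]
      exact ⟨hz, hw⟩
  refine of_isCell ⟨?_, ?_, ?_⟩ (hRQ D hDC (h3 D hD).2)
  · exact IsDef.and hC ((h3 D hD).1.isDef.comp σ)
  · rw [himg]
    exact (h3 D hD).1.isPreconnected.image _ (hφ.mono hDC)
  · exact Or.inr (hthin.mono fun z hz => hz.1)

end HasCells

/-- Cell decomposition for subsets of `ℝ^n`. -/
def CellDecomposition (L : FirstOrder.Language.{u, v}) [L.Structure ℝ] (n : ℕ) : Prop :=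
  ∀ S : Set (Fin n → ℝ), IsDef L S → HasCells L (fun _ => True) S

/-- Piecewise continuity of definable functions of `n` variables. -/
def PiecewiseContinuity (L : FirstOrder.Language.{u, v}) [L.Structure ℝ] (n : ℕ) : Prop :=
  ∀ (S : Set (Fin n → ℝ)) (f : (Fin n → ℝ) → ℝ), IsDefFun L S f → HasCells L (ContinuousOn f) S

/-- Uniform finiteness for definable families of finite subsets of the line with `n` parameters. -/
def UniformFiniteness (L : FirstOrder.Language.{u, v}) [L.Structure ℝ] (n : ℕ) : Prop :=
  ∀ A : (Fin n → ℝ) → Set ℝ, IsDefFam L A → (∀ x, (A x).Finite) → ∃ N, ∀ x, (A x).ncard ≤ N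

/-- On the points of continuity there is nothing to do. Open cells of the other points are empty,
since continuity is generic, and thin cells reduce to fewer variables. -/
theorem piecewiseContinuity_of_lt (hL : IsOMinimal L) (hcd : CellDecomposition L n)
    (ih : ∀ m < n, PiecewiseContinuity L m) : PiecewiseContinuity L n := by
  intro S f hf
  have hT := hf.isDef_continuousAt hL
  set T := {x | x ∈ interior S ∧ ContinuousAt f x} with hTdef
  have hTS : T ⊆ S := fun x hx => interior_subset hx.1
  have h1 : HasCells L (ContinuousOn f) T :=
    (hcd T hT).imp fun C hC _ _ x hx => (hC hx).2.continuousWithinAt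
  have h2 : HasCells L (ContinuousOn f) (S \ T) := by
    refine (hcd _ (hf.isDef_domain.sdiff hT)).bind fun C hC _ hCS => ?_
    rcases hC.isOpen_or_isThin with ho | ht
    · rcases C.eq_empty_or_nonempty with rfl | hne
      · exact HasCells.empty
      · exfalso
        obtain ⟨V, hVC, hV, ⟨x, hx⟩, hc⟩ :=
          hf.exists_open_continuousAt hL ho hne fun x hx => (hCS hx).1
        exact (hCS (hVC hx)).2 ⟨interior_maximal (fun y hy => (hCS (hVC hy)).1) hV hx, hc x hx⟩
    · obtain ⟨m, hm, σ, φ, hφ, hφC⟩ := id ht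
      have hfφ : IsDefFun L ((fun z i => z (σ i)) '' C) fun w => f (φ w) := by
        have h : IsDef L {w : Option (Fin m) → ℝ | ∃ z : Fin n → ℝ,
            (z ∈ C ∧ ∀ i, z (σ i) = w (some i)) ∧ (fun i => z i) ∈ S ∧ f (fun i => z i) = w none} :=
          IsDef.exists_vec (((hC.isDef.comp Sum.inr).and
            (IsDef.forall_fin fun i => IsDef.eq_var _ _)).and
            (hf.comp fun o => o.elim (Sum.inl none) Sum.inr))
        refine (congrArg (IsDef L) ?_).mp h
        ext w
        constructor
        · rintro ⟨z, ⟨hz, hzw⟩, -, hfz⟩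
          have h3 : (fun i => w (some i)) = fun i => z (σ i) := funext fun i => (hzw i).symm
          refine ⟨⟨z, hz, h3.symm⟩, ?_⟩
          simp only [h3, hφC z hz]
          exact hfz
        · rintro ⟨⟨z, hz, hzw⟩, hfz⟩
          refine ⟨z, ⟨hz, fun i => congrFun hzw i⟩, (hCS hz).1, ?_⟩
          have hfz' : f (φ fun i => w (some i)) = w none := hfz
          rw [← hzw] at hfz'
          simp only [hφC z hz] at hfz'
          exact hfz'
      refine HasCells.of_projection hC.isDef ht hφ hφC (ih m hm _ _ hfφ) fun D hD hfD => ?_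
      have h4 : ContinuousOn (fun z : Fin n → ℝ => f (φ fun i => z (σ i)))
          {z | z ∈ C ∧ (fun i => z (σ i)) ∈ D} :=
        hfD.comp (by fun_prop) fun z hz => hz.2
      exact h4.congr fun z hz => by simp only [hφC z hz.1]
  have := h1.union h2
  rwa [union_sdiff_cancel hTS] at this

/-- The cardinality of the fibres is constant on connected sets of good points. The other points
form no nonempty open cell, and thin cells reduce to fewer parameters. -/
theorem uniformFiniteness_of_lt (hL : IsOMinimal L) (hcd : CellDecomposition L n)
    (ih : ∀ m < n, UniformFiniteness L m) : UniformFiniteness L n := by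
  intro A hA hfin
  have hG := hA.isDef_isGoodPoint hL
  have main : ∀ C, IsCell L C → (C ⊆ {x | IsGoodPoint A x} ∨ C ⊆ {x | ¬ IsGoodPoint A x}) →
      ∃ N, ∀ x ∈ C, (A x).ncard ≤ N := by
    rintro C hC (hg | hb)
    · rcases C.eq_empty_or_nonempty with rfl | ⟨x, hx⟩
      · exact ⟨0, by simp⟩
      · refine ⟨(A x).ncard, fun y hy => le_of_eq ?_⟩
        refine hC.isPreconnected.constant (f := fun x => (A x).ncard) (fun z hz => ?_) hy hx
        refine ContinuousAt.continuousWithinAt ?_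
        rw [ContinuousAt, nhds_discrete ℕ, tendsto_pure]
        exact (hg hz).eventually_ncard_eq hfin
    · rcases hC.isOpen_or_isThin with ho | ⟨m, hm, σ, φ, -, hφC⟩
      · rcases C.eq_empty_or_nonempty with rfl | hne
        · exact ⟨0, by simp⟩
        · obtain ⟨x, hx, hgx⟩ := hA.exists_isGoodPoint hL hfin ho hne
          exact absurd hgx (hb hx)
      · let B : (Fin m → ℝ) → Set ℝ := fun w =>
          {t | ∃ z : Fin n → ℝ, (z ∈ C ∧ ∀ i, z (σ i) = w i) ∧ t ∈ A z}
        have hB : IsDefFam L B := IsDef.exists_vec (((hC.isDef.comp Sum.inr).and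
            (IsDef.forall_fin fun i => IsDef.eq_var _ _)).and (hA.mem Sum.inr (Sum.inl none)))
        have hBA : ∀ z ∈ C, ∀ w, (∀ i, z (σ i) = w i) → B w = A z := by
          intro z hz w hzw
          ext t
          constructor
          · rintro ⟨z', ⟨hz', hz'w⟩, ht⟩
            have : z' = z := by
              rw [← hφC z hz, ← hφC z' hz']
              exact congrArg φ (funext fun i => (hz'w i).trans (hzw i).symm)
            rwa [← this]
          · exact fun ht => ⟨z, ⟨hz, hzw⟩, ht⟩
        have hBfin : ∀ w, (B w).Finite := by
          intro w
          by_cases h : ∃ z : Fin n → ℝ, z ∈ C ∧ ∀ i, z (σ i) = w i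
          · obtain ⟨z, hz, hzw⟩ := h
            rw [hBA z hz w hzw]
            exact hfin z
          · convert finite_empty
            ext t
            simp only [mem_empty_iff_false, iff_false]
            rintro ⟨z, hz, -⟩
            exact h ⟨z, hz⟩
        obtain ⟨N, hN⟩ := ih m hm B hB hBfin
        exact ⟨N, fun x hx => (hBA x hx _ fun _ => rfl) ▸ hN _⟩
  have fin : ∀ S, HasCells L (fun C => C ⊆ {x | IsGoodPoint A x} ∨ C ⊆ {x | ¬ IsGoodPoint A x}) S →
      ∃ N, ∀ x ∈ S, (A x).ncard ≤ N := by
    rintro S ⟨𝒞, h1, rfl, h2⟩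
    choose! N hN using fun C hC => main C (h2 C hC).1 (h2 C hC).2
    obtain ⟨M, hM⟩ := (h1.image N).bddAbove
    exact ⟨M, fun x ⟨C, hC, hx⟩ => (hN C hC x hx).trans (hM (mem_image_of_mem N hC))⟩
  obtain ⟨N, hN⟩ := fin _ ((hcd _ hG).imp fun C hC _ _ => Or.inl hC)
  obtain ⟨M, hM⟩ := fin _ ((hcd _ hG.not).imp fun C hC _ _ => Or.inr hC)
  refine ⟨max N M, fun x => ?_⟩
  by_cases hx : IsGoodPoint A x
  · exact (hN x hx).trans (le_max_left _ _)
  · exact (hM x hx).trans (le_max_right _ _)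

end Cells

/-! ### Cell decomposition and uniform finiteness -/

section CellInduction

variable {L : FirstOrder.Language.{u, v}} [L.Structure ℝ] {n : ℕ}

/-- The point of `ℝ^(n+1)` with first coordinate `t` and remaining coordinates `x`. -/
def vcons (t : ℝ) (x : Fin n → ℝ) : Fin (n + 1) → ℝ := Fin.cons t x

theorem vcons_self_tail (z : Fin (n + 1) → ℝ) : vcons (z 0) (fun i => z i.succ) = z :=
  Fin.cons_self_tail z

theorem Continuous.vcons {X : Type*} [TopologicalSpace X] {f : X → ℝ} {g : X → Fin n → ℝ}
    (hf : Continuous f) (hg : Continuous g) : Continuous fun x => vcons (f x) (g x) := by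
  refine continuous_pi fun i => ?_
  refine Fin.cases ?_ (fun i => ?_) i
  · exact hf
  · exact (continuous_apply i).comp hg

theorem ContinuousOn.vcons {X : Type*} [TopologicalSpace X] {f : X → ℝ} {g : X → Fin n → ℝ}
    {s : Set X} (hf : ContinuousOn f s) (hg : ContinuousOn g s) :
    ContinuousOn (fun x => vcons (f x) (g x)) s :=
  (Continuous.vcons continuous_fst continuous_snd).comp_continuousOn (hf.prodMk hg)

theorem inter_frontier_nonempty_of_isPreconnected {X : Type*} [TopologicalSpace X] {s t : Set X}
    (hs : IsPreconnected s) (h : (s ∩ t).Nonempty) (h' : (s ∩ tᶜ).Nonempty) :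
    (s ∩ frontier t).Nonempty := by
  by_contra hne
  have key : ∀ x ∈ s, x ∉ frontier t := fun x hx hf => hne ⟨x, hx, hf⟩
  have h1 : ∀ u : Set X, frontier u = frontier t → ∀ x ∈ s, x ∈ u → x ∈ interior u :=
    fun u hu x hx hxu => by_contra fun hn => key x hx (hu ▸ ⟨subset_closure hxu, hn⟩)
  have h2 := h1 t rfl
  have h3 := h1 tᶜ (frontier_compl t)
  obtain ⟨x, -, hx⟩ := hs (interior t) (interior tᶜ) isOpen_interior isOpen_interior
    (fun x hx => (em (x ∈ t)).imp (h2 x hx) (h3 x hx))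
    (h.imp fun x hx => ⟨hx.1, h2 x hx.1 hx.2⟩) (h'.imp fun x hx => ⟨hx.1, h3 x hx.1 hx.2⟩)
  exact interior_subset hx.2 (interior_subset hx.1)

/-- A set over a connected base is connected if it is open relative to the base and its fibres are
nonempty intervals. -/
theorem isPreconnected_of_fibres {C : Set (Fin n → ℝ)} (hC : IsPreconnected C)
    {E : Set (Fin (n + 1) → ℝ)} (hEC : ∀ z ∈ E, (fun i => z i.succ) ∈ C)
    (hne : ∀ x ∈ C, ∃ t, vcons t x ∈ E)
    (hconn : ∀ x ∈ C, IsPreconnected {t | vcons t x ∈ E})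
    (hopen : ∀ z ∈ E, ∀ᶠ y : Fin (n + 1) → ℝ in 𝓝 z, (fun i => y i.succ) ∈ C → y ∈ E) :
    IsPreconnected E := by
  refine isPreconnected_of_forall_constant fun f hf => ?_
  choose! s hs using hne
  have hfib : ∀ x ∈ C, ∀ t, vcons t x ∈ E → f (vcons t x) = f (vcons (s x) x) := by
    intro x hx t ht
    refine (hconn x hx).constant (f := fun t => f (vcons t x)) ?_ ht (hs x hx)
    exact hf.comp (Continuous.vcons continuous_id continuous_const).continuousOn fun t ht => ht
  have hcont : ContinuousOn (fun x => f (vcons (s x) x)) C := by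
    intro x hx
    have hz := hs x hx
    have h1 : ∀ᶠ y in 𝓝 x, y ∈ C → vcons (s x) y ∈ E := by
      have : Tendsto (fun y => vcons (s x) y) (𝓝 x) (𝓝 (vcons (s x) x)) :=
        (Continuous.vcons continuous_const continuous_id).tendsto x
      exact this.eventually (hopen _ hz)
    have h2 : ContinuousWithinAt (fun y => f (vcons (s x) y)) {y | vcons (s x) y ∈ E} x :=
      ContinuousWithinAt.comp (t := E) (hf _ hz)
        (Continuous.vcons continuous_const continuous_id).continuousWithinAt fun y hy => hy
    have h3 : ContinuousWithinAt (fun y => f (vcons (s x) y)) C x := by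
      refine h2.mono_of_mem_nhdsWithin ?_
      rw [mem_nhdsWithin_iff_eventually]
      exact h1
    refine h3.congr_of_eventuallyEq ?_ rfl
    filter_upwards [nhdsWithin_le_nhds h1, self_mem_nhdsWithin] with y hy hyC
    exact (hfib y hyC _ (hy hyC)).symm
  intro x hx y hy
  have h1 := hfib _ (hEC x hx) (x 0) (by rwa [vcons_self_tail])
  have h2 := hfib _ (hEC y hy) (y 0) (by rwa [vcons_self_tail])
  rw [vcons_self_tail] at h1 h2
  rw [h1, h2]
  exact hC.constant (f := fun x => f (vcons (s x) x)) hcont (hEC x hx) (hEC y hy)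

/-- The graph of a continuous definable function over a connected definable set is a thin cell. -/
theorem IsCell.graph {C : Set (Fin n → ℝ)} (hC : IsCell L C) {f : (Fin n → ℝ) → ℝ}
    (hf : IsDefFun L C f) (hfc : ContinuousOn f C) :
    IsCell L {z : Fin (n + 1) → ℝ | (fun i => z i.succ) ∈ C ∧ f (fun i => z i.succ) = z 0} := by
  refine ⟨?_, ?_, Or.inr ⟨n, n.lt_succ_self, Fin.succ, fun x => vcons (f x) x, ?_, ?_⟩⟩
  · exact hf.comp fun o => o.elim 0 Fin.succ
  · have : {z : Fin (n + 1) → ℝ | (fun i => z i.succ) ∈ C ∧ f (fun i => z i.succ) = z 0} =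
        (fun x => vcons (f x) x) '' C := by
      ext z
      constructor
      · rintro ⟨h1, h2⟩
        refine ⟨_, h1, ?_⟩
        simp only [h2, vcons_self_tail]
      · rintro ⟨x, hx, rfl⟩
        exact ⟨hx, rfl⟩
    rw [this]
    exact hC.isPreconnected.image _ (hfc.vcons continuousOn_id)
  · refine (hfc.vcons continuousOn_id).mono ?_
    rintro _ ⟨z, hz, rfl⟩
    exact hz.1
  · rintro z ⟨h1, h2⟩
    simp only [h2, vcons_self_tail]

/-- The region over `C` above the graphs of the `f j` with `ε j = true` and below the others. -/
def bandOver {m : ℕ} (f : Fin m → (Fin n → ℝ) → ℝ) (ε : Fin m → Bool) (C : Set (Fin n → ℝ)) :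
    Set (Fin (n + 1) → ℝ) :=
  {z | (fun i => z i.succ) ∈ C ∧
    ∀ j, if ε j then f j (fun i => z i.succ) < z 0 else z 0 < f j (fun i => z i.succ)}

theorem isPreconnected_band_fibre {m : ℕ} (f : Fin m → (Fin n → ℝ) → ℝ) (ε : Fin m → Bool)
    (x : Fin n → ℝ) : IsPreconnected {t | ∀ j, if ε j then f j x < t else t < f j x} := by
  rw [isPreconnected_iff_ordConnected]
  refine ⟨fun a ha b hb t ht j => ?_⟩
  have h1 := ha j
  have h2 := hb j
  by_cases h : ε j
  · simp only [h, if_true] at h1 ⊢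
    exact h1.trans_le ht.1
  · simp only [h] at h2 ⊢
    exact ht.2.trans_lt h2

theorem isDef_bandOver (hL : IsOMinimal L) {m : ℕ} {f : Fin m → (Fin n → ℝ) → ℝ}
    {C : Set (Fin n → ℝ)} (hC : IsDef L C) (hf : ∀ j, IsDefFun L C (f j)) (ε : Fin m → Bool) :
    IsDef L (bandOver f ε C) := by
  have h : ∀ j, IsDef L {z : Fin (n + 1) → ℝ | (fun i => z i.succ) ∈ C ∧
      if ε j then f j (fun i => z i.succ) < z 0 else z 0 < f j (fun i => z i.succ)} := by
    intro j
    by_cases hj : ε j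
    · simp only [hj, if_true]
      exact (hf j).subst Fin.succ (P := fun z t => t < z 0) (hL.lt_var none (some 0))
    · simp only [hj]
      exact (hf j).subst Fin.succ (P := fun z t => z 0 < t) (hL.lt_var (some 0) none)
  refine (congrArg (IsDef L) ?_).mp ((hC.comp Fin.succ).and (IsDef.forall_fin h))
  ext z
  exact ⟨fun h => ⟨h.1, fun j => (h.2 j).2⟩, fun h => ⟨h.1, fun j => ⟨h.1, h.2 j⟩⟩⟩

/-- A band with nonempty fibres between graphs of continuous functions over a cell is a cell. -/
theorem IsCell.bandOver (hL : IsOMinimal L) {m : ℕ} {f : Fin m → (Fin n → ℝ) → ℝ}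
    {C : Set (Fin n → ℝ)} (hC : IsCell L C) (hf : ∀ j, IsDefFun L C (f j))
    (hfc : ∀ j, ContinuousOn (f j) C) (ε : Fin m → Bool)
    (hne : ∀ x ∈ C, ∃ t, vcons t x ∈ bandOver f ε C) : IsCell L (bandOver f ε C) := by
  have hopen : ∀ z ∈ _root_.bandOver f ε C, ∀ᶠ y : Fin (n + 1) → ℝ in 𝓝 z,
      (fun i => y i.succ) ∈ C → y ∈ _root_.bandOver f ε C := by
    rintro z ⟨hz, hz'⟩
    have htail : Tendsto (fun (y : Fin (n + 1) → ℝ) (i : Fin n) => y i.succ)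
        (𝓝[{y | (fun i => y i.succ) ∈ C}] z) (𝓝[C] fun i => z i.succ) :=
      ContinuousWithinAt.tendsto_nhdsWithin
        ((by fun_prop : Continuous fun (y : Fin (n + 1) → ℝ) (i : Fin n) =>
          y i.succ).continuousWithinAt) fun y hy => hy
    have h0 : Tendsto (fun y : Fin (n + 1) → ℝ => y 0)
        (𝓝[{y | (fun i => y i.succ) ∈ C}] z) (𝓝 (z 0)) :=
      (continuous_apply 0).continuousWithinAt
    have hj : ∀ j, Tendsto (fun y : Fin (n + 1) → ℝ => f j fun i => y i.succ)
        (𝓝[{y | (fun i => y i.succ) ∈ C}] z) (𝓝 (f j fun i => z i.succ)) := fun j =>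
      (hfc j _ hz).tendsto.comp htail
    have h1 : ∀ᶠ y : Fin (n + 1) → ℝ in 𝓝[{y | (fun i => y i.succ) ∈ C}] z,
        ∀ j, if ε j then f j (fun i => y i.succ) < y 0 else y 0 < f j (fun i => y i.succ) := by
      rw [eventually_all]
      intro j
      have hzj := hz' j
      by_cases h : ε j
      · simp only [h, if_true] at hzj ⊢
        exact (hj j).eventually_lt h0 hzj
      · simp only [h] at hzj ⊢
        exact h0.eventually_lt (hj j) hzj
    rw [eventually_nhdsWithin_iff] at h1
    exact h1.mono fun y hy hyC => ⟨hyC, hy hyC⟩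
  refine ⟨isDef_bandOver hL hC.isDef hf ε, ?_, ?_⟩
  · refine isPreconnected_of_fibres hC.isPreconnected (fun z hz => hz.1) hne (fun x hx => ?_) hopen
    have := isPreconnected_band_fibre f ε x
    convert this using 1
    ext t
    exact ⟨fun h => h.2, fun h => ⟨hx, h⟩⟩
  · rcases hC.isOpen_or_isThin with ho | ⟨k, hk, σ, φ, hφ, hφC⟩
    · left
      rw [isOpen_iff_mem_nhds]
      intro z hz
      have h1 : ∀ᶠ y : Fin (n + 1) → ℝ in 𝓝 z, (fun i => y i.succ) ∈ C :=
        ((by fun_prop : Continuous fun (y : Fin (n + 1) → ℝ) (i : Fin n) =>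
          y i.succ).continuousAt.eventually (ho.mem_nhds hz.1))
      filter_upwards [hopen z hz, h1] with y hy hyC using hy hyC
    · right
      refine ⟨k + 1, by omega, Fin.cases 0 fun i => (σ i).succ,
        fun w => vcons (w 0) (φ fun i => w i.succ), ?_, ?_⟩
      · refine ContinuousOn.vcons (continuous_apply 0).continuousOn (hφ.comp (by fun_prop) ?_)
        rintro _ ⟨z, hz, rfl⟩
        exact ⟨_, hz.1, rfl⟩
      · rintro z hz
        have := hφC _ hz.1
        simp only [Fin.cases_zero, Fin.cases_succ]
        rw [this, vcons_self_tail]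

/-- A definable set over `S` whose fibres have their frontiers on finitely many graphs decomposes
into cells: graphs and bands. -/
theorem hasCells_of_frontier_fibres (hL : IsOMinimal L) (hcd : CellDecomposition L n)
    (hpc : PiecewiseContinuity L n) {S : Set (Fin n → ℝ)} (hS : IsDef L S) {m : ℕ}
    {f : Fin m → (Fin n → ℝ) → ℝ} (hf : ∀ j, IsDefFun L S (f j)) {D : Set (Fin (n + 1) → ℝ)}
    (hD : IsDef L D)
    (hfr : ∀ x ∈ S, ∀ t, t ∈ frontier {t | vcons t x ∈ D} → ∃ j, f j x = t) :
    HasCells L (fun _ => True) {z | (fun i => z i.succ) ∈ S ∧ z ∈ D} := by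
  -- the three definable conditions on a base point that have to be constant on the base cells
  let T : Fin m ⊕ (Fin m → Bool) × Bool → Set (Fin n → ℝ) := fun a =>
    match a with
    | Sum.inl j => {x | x ∈ S ∧ vcons (f j x) x ∈ D}
    | Sum.inr (ε, false) => {x | ∃ t, vcons t x ∈ bandOver f ε S}
    | Sum.inr (ε, true) => {x | ∀ t, vcons t x ∈ bandOver f ε S → vcons t x ∈ D}
  have hvz : ∀ z : Option (Fin n) → ℝ, vcons (z none) (fun i => z (some i)) =
      fun k => z ((Fin.cases none some k : Option (Fin n))) := by
    intro z
    ext k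
    refine Fin.cases rfl (fun i => rfl) k
  have hvc : ∀ {E : Set (Fin (n + 1) → ℝ)}, IsDef L E →
      IsDef L {z : Option (Fin n) → ℝ | vcons (z none) (fun i => z (some i)) ∈ E} := by
    intro E hE
    simp only [hvz]
    exact hE.comp _
  have hT : ∀ a, IsDef L (T a) := by
    rintro (j | ⟨ε, _ | _⟩)
    · exact (hf j).subst id (P := fun x t => vcons t x ∈ D) (hvc hD)
    · exact IsDef.exists_real (hvc (isDef_bandOver hL hS hf ε))
    · exact IsDef.forall_real ((hvc (isDef_bandOver hL hS hf ε)).imp (hvc hD))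
  have hcd' : ∀ R ⊆ S, IsDef L R → HasCells L (fun _ => True) R := fun R _ hR => hcd R hR
  have h1 := HasCells.forall_finset (L := L) (S := S) Finset.univ
    (Q := fun a C => C ⊆ T a ∨ C ⊆ (T a)ᶜ)
    (fun a C E hCE h => h.imp hCE.trans hCE.trans) hcd' (fun a _ R hRS hR => by
      have h := ((hcd (R ∩ T a) (hR.inter (hT a))).imp (R := fun C => C ⊆ T a ∨ C ⊆ (T a)ᶜ)
        fun C hC _ _ => Or.inl fun x hx => (hC hx).2).union
        ((hcd (R \ T a) (hR.sdiff (hT a))).imp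
          fun C hC _ _ => Or.inr fun x hx => (hC hx).2)
      rwa [inter_union_sdiff] at h)
  have h2 := HasCells.forall_finset (L := L) (S := S) Finset.univ
    (Q := fun j C => ContinuousOn (f j) C)
    (fun a C E hCE h => h.mono hCE) hcd' (fun j _ R hRS hR => hpc R _ ((hf j).mono hR hRS))
  have h3 : HasCells L (fun C => (∀ a, C ⊆ T a ∨ C ⊆ (T a)ᶜ) ∧ ∀ j, ContinuousOn (f j) C) S :=
    (h1 S subset_rfl hS).bind fun C hC hCT hCS => (h2 C hCS hC.isDef).imp fun E hEC _ hE =>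
      ⟨fun a => (hCT a (Finset.mem_univ a)).imp hEC.trans hEC.trans,
        fun j => hE j (Finset.mem_univ j)⟩
  obtain ⟨𝒞, h𝒞, rfl, hC⟩ := h3
  have hU : {z : Fin (n + 1) → ℝ | (fun i => z i.succ) ∈ ⋃₀ 𝒞 ∧ z ∈ D} =
      ⋃ C ∈ 𝒞, {z : Fin (n + 1) → ℝ | (fun i => z i.succ) ∈ C ∧ z ∈ D} := by
    ext z
    simp only [mem_iUnion]
    constructor
    · rintro ⟨⟨C, hC, hzC⟩, hz⟩
      exact ⟨C, hC, hzC, hz⟩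
    · rintro ⟨C, hC, hzC, hz⟩
      exact ⟨⟨C, hC, hzC⟩, hz⟩
  rw [hU]
  refine HasCells.biUnion h𝒞 fun C hC𝒞 => ?_
  obtain ⟨hcell, hCT, hCf⟩ := hC C hC𝒞
  have hCS : C ⊆ ⋃₀ 𝒞 := subset_sUnion_of_mem hC𝒞
  rcases C.eq_empty_or_nonempty with rfl | ⟨x₀, hx₀⟩
  · simpa using HasCells.empty
  -- the pieces over `C` contained in `D`
  let piece : Fin m ⊕ (Fin m → Bool) → Set (Fin (n + 1) → ℝ) := fun a =>
    match a with
    | Sum.inl j => {z | (fun i => z i.succ) ∈ C ∧ f j (fun i => z i.succ) = z 0}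
    | Sum.inr ε => bandOver f ε C
  have hpiece : {z : Fin (n + 1) → ℝ | (fun i => z i.succ) ∈ C ∧ z ∈ D} =
      ⋃ a ∈ {a | piece a ⊆ D}, piece a := by
    ext z
    simp only [mem_iUnion]
    constructor
    · rintro ⟨hzC, hzD⟩
      by_cases hz : ∃ j, f j (fun i => z i.succ) = z 0
      · obtain ⟨j, hj⟩ := hz
        refine ⟨Sum.inl j, ?_, hzC, hj⟩
        rintro y ⟨hyC, hy⟩
        rcases hCT (Sum.inl j) with h | h
        · have := (h hyC).2
          rwa [hy, vcons_self_tail] at this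
        · refine absurd ?_ (h hzC)
          refine ⟨hCS hzC, ?_⟩
          rwa [hj, vcons_self_tail]
      · push Not at hz
        let ε : Fin m → Bool := fun j => decide (f j (fun i => z i.succ) < z 0)
        have hzε : z ∈ bandOver f ε C := by
          refine ⟨hzC, fun j => ?_⟩
          by_cases h : f j (fun i => z i.succ) < z 0
          · simp [ε, h]
          · have := lt_of_le_of_ne (not_lt.mp h) (hz j).symm
            simp [ε, h, this]
        refine ⟨Sum.inr ε, ?_, hzε⟩
        rintro y ⟨hyC, hy⟩
        rcases hCT (Sum.inr (ε, true)) with h | h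
        · have := h hyC (y 0) (by rw [vcons_self_tail]; exact ⟨hCS hyC, hy⟩)
          rwa [vcons_self_tail] at this
        · refine absurd ?_ (h hzC)
          rintro t ⟨-, ht⟩
          by_contra htD
          -- an interval meeting a set and its complement meets the frontier
          obtain ⟨s, hs, hsD⟩ := inter_frontier_nonempty_of_isPreconnected
            (isPreconnected_band_fibre f ε fun i => z i.succ)
            (t := {t | vcons t (fun i => z i.succ) ∈ D})
            ⟨z 0, hzε.2, by rw [← vcons_self_tail z] at hzD; exact hzD⟩ ⟨t, ht, htD⟩
          obtain ⟨j, hj⟩ := hfr _ (hCS hzC) s hsD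
          have := hs j
          by_cases h : ε j <;> simp [h, hj] at this
    · rintro ⟨a, ha, hza⟩
      refine ⟨?_, ha hza⟩
      rcases a with j | ε
      · exact hza.1
      · exact hza.1
  rw [hpiece]
  refine HasCells.biUnion (Set.toFinite _) fun a ha => ?_
  rcases a with j | ε
  · exact HasCells.of_isCell (hcell.graph ((hf j).mono hcell.isDef hCS) (hCf j)) trivial
  · rcases hCT (Sum.inr (ε, false)) with h | h
    · refine HasCells.of_isCell (hcell.bandOver hL (fun j => (hf j).mono hcell.isDef hCS) hCf ε
        fun x hx => ?_) trivial
      obtain ⟨t, ht⟩ := h hx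
      exact ⟨t, hx, ht.2⟩
    · convert HasCells.empty
      refine Set.eq_empty_iff_forall_notMem.mpr fun z hz => h hz.1 ⟨z 0, ?_⟩
      rw [vcons_self_tail]
      exact ⟨hCS hz.1, hz.2⟩

theorem cellDecomposition_succ (hL : IsOMinimal L) (hcd : CellDecomposition L n)
    (hpc : PiecewiseContinuity L n) (huf : UniformFiniteness L n) :
    CellDecomposition L (n + 1) := by
  intro D hD
  let A : (Fin n → ℝ) → Set ℝ := fun x => frontier {t | vcons t x ∈ D}
  have hvz : ∀ z : Option (Fin n) → ℝ, vcons (z none) (fun i => z (some i)) =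
      fun k => z ((Fin.cases none some k : Option (Fin n))) := by
    intro z
    ext k
    refine Fin.cases rfl (fun i => rfl) k
  have hD' : IsDef L {z : Option (Fin n) → ℝ | vcons (z none) (fun i => z (some i)) ∈ D} := by
    simp only [hvz]
    exact hD.comp _
  have hA : IsDefFam L A := by
    have h : IsDef L {z : Option (Fin n) → ℝ | ∀ a b, (a < z none ∧ z none < b) →
        (∃ t, (a < t ∧ t < b) ∧ vcons t (fun i => z (some i)) ∈ D) ∧
        ∃ t, (a < t ∧ t < b) ∧ ¬ vcons t (fun i => z (some i)) ∈ D} := by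
      have h' : IsDef L {z : Option (Option (Option (Option (Fin n)))) → ℝ |
          vcons (z none) (fun i => z (some (some (some (some i))))) ∈ D} :=
        hD'.comp fun o => o.elim none fun i => some (some (some (some i)))
      refine IsDef.forall_real (IsDef.forall_real (((hL.lt_var _ _).and (hL.lt_var _ _)).imp ?_))
      exact (IsDef.exists_real (((hL.lt_var (some (some none)) none).and
        (hL.lt_var none (some none))).and h')).and
        (IsDef.exists_real (((hL.lt_var (some (some none)) none).and
        (hL.lt_var none (some none))).and h'.not))
    refine (congrArg (IsDef L) ?_).mp h
    ext z
    change _ ↔ z none ∈ frontier _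
    have key : ∀ E : Set ℝ, z none ∈ closure E ↔
        ∀ a b, (a < z none ∧ z none < b) → ∃ t, (a < t ∧ t < b) ∧ t ∈ E := by
      intro E
      rw [mem_closure_iff_nhds_basis (nhds_basis_Ioo (z none))]
      exact ⟨fun h a b hab => (h (i := (a, b)) hab).imp fun t ht => ⟨ht.2, ht.1⟩,
        fun h i hi => (h i.1 i.2 hi).imp fun t ht => ⟨ht.2, ht.1⟩⟩
    rw [frontier_eq_closure_inter_closure]
    refine Iff.trans ?_ (and_congr (key _) (key _)).symm
    exact ⟨fun h => ⟨fun a b hab => (h a b hab).1, fun a b hab => (h a b hab).2⟩,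
      fun h a b hab => ⟨h.1 a b hab, h.2 a b hab⟩⟩
  have hfin : ∀ x, (A x).Finite := fun x =>
    hL.finite_frontier (IsDef.fix_real (P := fun x t => vcons t x ∈ D) hD' x)
  obtain ⟨N, hN⟩ := huf A hA hfin
  have hU : D = ⋃ m ∈ Iic N, {z | (fun i => z i.succ) ∈ {x | (A x).ncard = m} ∧ z ∈ D} := by
    ext z
    simp only [mem_iUnion]
    exact ⟨fun h => ⟨_, hN _, rfl, h⟩, fun ⟨m, _, _, h⟩ => h⟩
  rw [hU]
  refine HasCells.biUnion (finite_Iic N) fun m _ => ?_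
  refine hasCells_of_frontier_fibres hL hcd hpc (hA.ncard_eq hL hfin m)
    (f := fun (j : Fin m) x => nthElt (A x) j) (fun j => hA.isDefFun_nthElt hL hfin j.2) hD ?_
  intro x hx t ht
  exact ⟨⟨_, (ncard_inter_Iio_lt (hfin x) ht).trans_eq hx⟩, nthElt_ncard_inter_Iio (hfin x) ht⟩

/-- Cell decomposition, piecewise continuity and uniform finiteness hold in all dimensions. They
are proved by a simultaneous induction on the dimension. -/
theorem cellDecomposition_and (hL : IsOMinimal L) (n : ℕ) :
    CellDecomposition L n ∧ PiecewiseContinuity L n ∧ UniformFiniteness L n := by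
  induction n using Nat.strong_induction_on with
  | _ n ih =>
    have hcd : CellDecomposition L n := by
      cases n with
      | zero =>
        exact fun S hS => HasCells.of_isCell
          ⟨hS, subsingleton_of_subsingleton.isPreconnected, Or.inl (isOpen_discrete S)⟩ trivial
      | succ n =>
        obtain ⟨h1, h2, h3⟩ := ih n n.lt_succ_self
        exact cellDecomposition_succ hL h1 h2 h3
    exact ⟨hcd, piecewiseContinuity_of_lt hL hcd fun m hm => (ih m hm).2.1,
      uniformFiniteness_of_lt hL hcd fun m hm => (ih m hm).2.2⟩

/-- Uniform finiteness: a definable family of finite subsets of the line has bounded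
cardinalities. -/
theorem IsDefFam.exists_ncard_le (hL : IsOMinimal L) {ι : Type} [Finite ι]
    {A : (ι → ℝ) → Set ℝ} (hA : IsDefFam L A) (hfin : ∀ x, (A x).Finite) :
    ∃ N, ∀ x, (A x).ncard ≤ N := by
  obtain ⟨n, ⟨e⟩⟩ := Finite.exists_equiv_fin ι
  obtain ⟨N, hN⟩ := (cellDecomposition_and hL n).2.2 (fun x => A fun i => x (e i))
    (hA.mem (fun i => some (e i)) none) fun x => hfin _
  refine ⟨N, fun x => ?_⟩
  simpa using hN fun k => x (e.symm k)

end CellInduction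

/-! ### Definable families of sets without interior -/

section ThinFamilies

variable {L : FirstOrder.Language.{u, v}} [L.Structure ℝ] {ι κ : Type}

theorem isDef_frontier_family (hL : IsOMinimal L) [Finite ι] [Finite κ]
    {Q : (κ → ℝ) → Set (ι → ℝ)}
    (hQ : IsDef L {z : κ ⊕ ι → ℝ | (fun i => z (Sum.inr i)) ∈ Q fun k => z (Sum.inl k)}) :
    IsDef L {z : κ ⊕ ι → ℝ | (fun i => z (Sum.inr i)) ∈ frontier (Q fun k => z (Sum.inl k))} := by
  have hQ' : IsDef L {z : (κ ⊕ ι) ⊕ ι → ℝ | (fun i => z (Sum.inr i)) ∈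
      Q fun k => z (Sum.inl (Sum.inl k))} :=
    hQ.comp (Sum.elim (fun k => Sum.inl (Sum.inl k)) Sum.inr)
  have h := (IsDef.eventually_nhds hL (Sum.inr : ι → κ ⊕ ι)
    (P := fun z y => y ∈ Q fun k => z (Sum.inl k)) hQ').not.and
    (IsDef.eventually_nhds hL (Sum.inr : ι → κ ⊕ ι)
    (P := fun z y => ¬ y ∈ Q fun k => z (Sum.inl k)) hQ'.not).not
  refine (congrArg (IsDef L) ?_).mp h
  ext z
  change _ ↔ _ ∈ frontier _
  rw [frontier_eq_closure_inter_closure, mem_inter_iff, mem_closure_iff_frequently,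
    mem_closure_iff_frequently, and_comm, Filter.Frequently, Filter.Frequently]
  simp only [mem_compl_iff, not_not]
  rfl

/-- Among `N + 1` disjoint intervals, one contains no point of a given set of at most `N` points. -/
theorem exists_interval_disjoint {r : ℕ → ℝ} (hr : StrictMono r) {s : Set ℝ} (hs : s.Finite)
    {N : ℕ} (hN : s.ncard ≤ N) : ∃ j : Fin (N + 1), ∀ t ∈ Ioo (r j) (r (j + 1)), t ∉ s := by
  by_contra! h
  choose t ht hts using h
  have hmono : StrictMono t := by
    intro i j hij
    exact (ht i).2.trans ((hr.monotone (by exact hij)).trans_lt (ht j).1)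
  have h1 : (range t).ncard ≤ s.ncard := ncard_le_ncard (range_subset_iff.mpr hts) hs
  rw [← image_univ, ncard_image_of_injective _ hmono.injective, ncard_univ, Nat.card_fin] at h1
  omega

/-- For a definable family of subsets of `ℝ^ι` and an open set `U` there are finitely many nonempty
open subsets of `U` such that each member of the family without interior misses one of them. The
induction on the dimension uses uniform finiteness: over the points of the base whose fibre is
finite, one of `N + 1` fixed intervals is missed, and the set of base points where a given interval
is missed has a frontier without interior. -/
theorem exists_finite_open_missed (hL : IsOMinimal L) [Finite ι] [Finite κ] :
    ∀ E : (κ → ℝ) → Set (ι → ℝ),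
      IsDef L {z : κ ⊕ ι → ℝ | (fun i => z (Sum.inr i)) ∈ E fun k => z (Sum.inl k)} →
      ∀ U : Set (ι → ℝ), IsOpen U → U.Nonempty → ∃ F : Set (Set (ι → ℝ)), F.Finite ∧
        (∀ O ∈ F, O ⊆ U ∧ IsOpen O ∧ O.Nonempty ∧ IsPreconnected O) ∧
        ∀ y, interior (E y) = ∅ → ∃ O ∈ F, ∀ x ∈ O, x ∉ E y := by
  refine Finite.induction_empty_option (P := fun ι => ∀ E : (κ → ℝ) → Set (ι → ℝ),
      IsDef L {z : κ ⊕ ι → ℝ | (fun i => z (Sum.inr i)) ∈ E fun k => z (Sum.inl k)} →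
      ∀ U : Set (ι → ℝ), IsOpen U → U.Nonempty → ∃ F : Set (Set (ι → ℝ)), F.Finite ∧
        (∀ O ∈ F, O ⊆ U ∧ IsOpen O ∧ O.Nonempty ∧ IsPreconnected O) ∧
        ∀ y, interior (E y) = ∅ → ∃ O ∈ F, ∀ x ∈ O, x ∉ E y) ?_ ?_ ?_ ι
  · intro α β e h E hE U hU hne
    let Φ : (α → ℝ) ≃ₜ (β → ℝ) := Homeomorph.piCongrLeft (Y := fun _ => ℝ) e
    have hΦ : ∀ x, Φ x = fun k => x (e.symm k) := by
      intro x
      ext k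
      have := Equiv.piCongrLeft_apply_apply (P := fun _ => ℝ) e x (e.symm k)
      rwa [e.apply_symm_apply] at this
    obtain ⟨F, hF, hFU, hFE⟩ := h (fun y => Φ ⁻¹' E y) (by
      simp only [mem_preimage, hΦ]
      exact hE.comp (Sum.map id e.symm)) (Φ ⁻¹' U) (hU.preimage Φ.continuous)
      (hne.preimage Φ.surjective)
    refine ⟨(fun O => Φ '' O) '' F, hF.image _, ?_, fun y hy => ?_⟩
    · rintro _ ⟨O, hO, rfl⟩
      obtain ⟨h1, h2, h3, h4⟩ := hFU O hO
      exact ⟨image_subset_iff.mpr h1, Φ.isOpenMap O h2, h3.image _,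
        h4.image _ Φ.continuous.continuousOn⟩
    · obtain ⟨O, hO, hOE⟩ := hFE y (by rw [← Φ.preimage_interior, hy, preimage_empty])
      refine ⟨_, mem_image_of_mem _ hO, ?_⟩
      rintro _ ⟨x, hx, rfl⟩
      exact hOE x hx
  · intro E _ U _ hne
    refine ⟨{univ}, finite_singleton _, ?_, fun y hy => ⟨univ, rfl, fun x _ hx => ?_⟩⟩
    · rintro _ rfl
      exact ⟨(Subsingleton.eq_univ_of_nonempty hne).symm.subset, isOpen_univ, univ_nonempty,
        subsingleton_of_subsingleton.isPreconnected⟩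
    · rw [(isOpen_discrete _).interior_eq] at hy
      exact (hy ▸ hx : x ∈ (∅ : Set _))
  · intro α _ ih E hE U hU hne
    obtain ⟨V, hV, hVne, a, b, hab, hVU⟩ := exists_prod_subset_of_isOpen_option hU hne
    let g : (α → ℝ) → ℝ → (Option α → ℝ) := fun x t o => o.elim t x
    have hgz : ∀ z : Option α → ℝ, g (fun i => z (some i)) (z none) = z := by
      intro z; ext o; cases o <;> rfl
    have hgc : Continuous fun p : (α → ℝ) × ℝ => g p.1 p.2 := by
      refine continuous_pi fun o => ?_
      cases o with
      | none => exact continuous_snd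
      | some i => exact (continuous_apply i).comp continuous_fst
    -- the fibres over the points of `ℝ^κ × ℝ^α`, and those of them that contain an interval
    let B : (κ ⊕ α → ℝ) → Set ℝ := fun w =>
      {t | g (fun i => w (Sum.inr i)) t ∈ E fun k => w (Sum.inl k)}
    have hgcomp : ∀ {γ : Type} (z : γ → ℝ) (σ : α → γ) (j : γ),
        g (fun i => z (σ i)) (z j) = fun o => z (o.elim j σ) := by
      intro γ z σ j; ext o; cases o <;> rfl
    have hB : IsDefFam L B := by
      change IsDef L {z : Option (κ ⊕ α) → ℝ | g (fun i => z (some (Sum.inr i))) (z none) ∈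
        E fun k => z (some (Sum.inl k))}
      simp only [hgcomp _ (fun i => some (Sum.inr i))]
      exact hE.comp (Sum.elim (fun k => some (Sum.inl k))
        fun o => o.elim none fun i => some (Sum.inr i))
    let C : Set (κ ⊕ α → ℝ) := {w | ∃ p q, p < q ∧ ∀ t, (p < t ∧ t < q) → t ∈ B w}
    have hC : IsDef L C := IsDef.exists_real (IsDef.exists_real ((hL.lt_var _ _).and
      (IsDef.forall_real (((hL.lt_var _ _).and (hL.lt_var _ _)).imp
        (hB.mem (fun i => some (some (some i))) none)))))
    have hBfix : ∀ w, (univ : Set ℝ).Definable₁ L (B w) := fun w =>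
      IsDef.fix_real (P := fun w t => t ∈ B w) hB w
    let A : (κ ⊕ α → ℝ) → Set ℝ := fun w => {t | t ∈ B w ∧ w ∉ C}
    have hA : IsDefFam L A := IsDef.and hB (hC.comp some).not
    have hBfin : ∀ w, w ∉ C → (B w).Finite := fun w hw =>
      hL.finite_of_no_interval (hBfix w) hw
    have hAfin : ∀ w, (A w).Finite := by
      intro w
      by_cases hw : w ∈ C
      · refine finite_empty.subset fun t ht => ht.2 hw
      · exact (hBfin w hw).subset fun t ht => ht.1
    obtain ⟨N, hN⟩ := hA.exists_ncard_le hL hAfin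
    -- a strictly increasing sequence in `[a, b)`
    let r : ℕ → ℝ := fun j => b - (b - a) / (j + 1)
    have hr : StrictMono r := by
      refine strictMono_nat_of_lt_succ fun j => ?_
      have h1 : (0 : ℝ) < j + 1 := by positivity
      have h2 : (b - a) / ((j : ℝ) + 1 + 1) < (b - a) / (j + 1) :=
        div_lt_div_of_pos_left (sub_pos.mpr hab) h1 (by linarith)
      simp only [r]
      push_cast
      linarith
    have hra : ∀ j, a ≤ r j := fun j => by
      have : r 0 = a := by simp [r]
      exact this ▸ hr.monotone (Nat.zero_le j)
    have hrb : ∀ j, r j < b := fun j => by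
      have : 0 < (b - a) / ((j : ℝ) + 1) := div_pos (sub_pos.mpr hab) (by positivity)
      simp only [r]
      linarith
    let Q : ℕ → (κ → ℝ) → Set (α → ℝ) := fun j y =>
      {x | ∀ t, (r j < t ∧ t < r (j + 1)) → t ∉ B (Sum.elim y x)}
    have hsum : ∀ z : κ ⊕ α → ℝ,
        Sum.elim (fun k => z (Sum.inl k)) (fun i => z (Sum.inr i)) = z := by
      intro z; ext o; cases o <;> rfl
    have hQ : ∀ j, IsDef L {z : κ ⊕ α → ℝ | (fun i => z (Sum.inr i)) ∈
        Q j fun k => z (Sum.inl k)} := by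
      intro j
      have h : IsDef L {z : κ ⊕ α → ℝ | ∀ t, (r j < t ∧ t < r (j + 1)) → t ∉ B z} :=
        IsDef.forall_real (((hL.const_lt _ _).and (hL.lt_const _ _)).imp hB.not)
      simpa only [Q, mem_ofPred_eq, hsum] using h
    have hCfam : IsDef L {z : κ ⊕ α → ℝ | (fun i => z (Sum.inr i)) ∈
        {x | Sum.elim (fun k => z (Sum.inl k)) x ∈ C}} := by
      simp only [mem_ofPred_eq, hsum]
      exact hC
    let E' : (κ → ℝ) → Set (α → ℝ) := fun y =>
      {x | Sum.elim y x ∈ C ∨ ∃ j : Fin (N + 1), x ∈ frontier (Q j y)}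
    have hE' : IsDef L {z : κ ⊕ α → ℝ | (fun i => z (Sum.inr i)) ∈ E' fun k => z (Sum.inl k)} :=
      hCfam.or (IsDef.exists_fin fun j => isDef_frontier_family hL (hQ j))
    obtain ⟨F, hF, hFV, hFE⟩ := ih E' hE' V hV hVne
    let box : Set (α → ℝ) → Fin (N + 1) → Set (Option α → ℝ) := fun O j =>
      {z | (fun i => z (some i)) ∈ O ∧ z none ∈ Ioo (r j) (r (j + 1))}
    refine ⟨image2 box F univ, hF.image2 _ (Set.toFinite _), ?_, fun y hy => ?_⟩
    · rintro _ ⟨O, hO, j, -, rfl⟩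
      obtain ⟨h1, h2, h3, h4⟩ := hFV O hO
      have himg : box O j = (fun p : (α → ℝ) × ℝ => g p.1 p.2) '' (O ×ˢ Ioo (r j) (r (j + 1))) := by
        ext z
        constructor
        · rintro ⟨h1, h2⟩
          exact ⟨(_, _), ⟨h1, h2⟩, hgz z⟩
        · rintro ⟨p, ⟨h1, h2⟩, rfl⟩
          exact ⟨h1, h2⟩
      refine ⟨fun z hz => hVU z (h1 hz.1) ⟨(hra j).trans_lt hz.2.1, hz.2.2.trans (hrb _)⟩,
        isOpen_option_prod h2 _ _, ?_, ?_⟩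
      · rw [himg]
        exact (h3.prod (nonempty_Ioo.mpr (hr (Nat.lt_succ_self j)))).image _
      · rw [himg]
        exact (h4.prod isPreconnected_Ioo).image _ hgc.continuousOn
    · have hyE' : interior (E' y) = ∅ := by
        by_contra hne
        have hdC : IsDef L {x | Sum.elim y x ∈ C} :=
          IsDef.fix (P := fun y x => Sum.elim y x ∈ C) hCfam y
        have hdQ : ∀ j, IsDef L (Q j y) := fun j =>
          IsDef.fix (P := fun y x => x ∈ Q j y) (hQ j) y
        obtain ⟨c, W, hWE, hW, hWne, hWc⟩ := exists_open_subset_of_countable_cover hL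
          (D := fun c : Option (Fin (N + 1)) =>
            c.elim {x | Sum.elim y x ∈ C} fun j => frontier (Q j y))
          (fun c => by
            cases c with
            | none => exact hdC
            | some j => exact isDef_frontier hL (hdQ j))
          isOpen_interior (nonempty_iff_ne_empty.mpr hne) (fun x hx => by
            rcases interior_subset hx with h | ⟨j, hj⟩
            · exact ⟨none, h⟩
            · exact ⟨some j, hj⟩)
        cases c with
        | none =>
          obtain ⟨W', hW'W, hW', hW'ne, p, q, hpq, hbox⟩ := exists_box_of_fibres_contain_intervals
            hL (A := fun x t => t ∈ B (Sum.elim y x)) (by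
              refine IsDef.fix (P := fun (y : κ → ℝ) (z : Option α → ℝ) =>
                z none ∈ B (Sum.elim y fun i => z (some i))) ?_ y
              have h := hB.mem (Sum.elim (fun k => Sum.inl k) (fun i => Sum.inr (some i)) :
                κ ⊕ α → κ ⊕ Option α) (Sum.inr none)
              refine (congrArg (IsDef L) ?_).mp h
              ext z
              have : (fun i => z (Sum.elim (fun k => Sum.inl k) (fun i => Sum.inr (some i)) i)) =
                  Sum.elim (fun k => z (Sum.inl k)) fun i => z (Sum.inr (some i)) := by
                ext i; cases i <;> rfl
              exact iff_of_eq (congrArg (fun w => z (Sum.inr none) ∈ B w) this)) hW hWne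
            (fun x hx => by
              obtain ⟨p, q, hpq, h⟩ := hWc hx
              exact ⟨p, q, hpq, fun t ht => h t ht⟩)
          obtain ⟨x, hx⟩ := hW'ne
          have hsub : {z : Option α → ℝ | (fun i => z (some i)) ∈ W' ∧ z none ∈ Ioo p q} ⊆ E y := by
            rintro z ⟨h1, h2⟩
            have h3 : g (fun i => z (some i)) (z none) ∈ E y := hbox _ h1 _ h2
            rwa [hgz] at h3
          have hmem : g x ((p + q) / 2) ∈ interior (E y) :=
            interior_maximal hsub (isOpen_option_prod hW' p q)
              ⟨hx, by constructor <;> simp only [g, Option.elim] <;> linarith⟩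
          rw [hy] at hmem
          exact hmem
        | some j =>
          have h1 : W ⊆ interior (frontier (Q j y)) := interior_maximal hWc hW
          rw [(hdQ j).interior_frontier_eq_empty hL] at h1
          exact hWne.ne_empty (subset_empty_iff.mp h1)
      obtain ⟨O, hO, hOE⟩ := hFE y hyE'
      obtain ⟨-, -, ⟨x₀, hx₀⟩, hOconn⟩ := hFV O hO
      have hx₀C : Sum.elim y x₀ ∉ C := fun h => hOE x₀ hx₀ (Or.inl h)
      obtain ⟨j, hj⟩ := exists_interval_disjoint hr (hAfin (Sum.elim y x₀)) (hN _)
      refine ⟨box O j, mem_image2_of_mem hO (mem_univ j), ?_⟩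
      have hOQ : O ⊆ Q j y := by
        intro x hx
        by_contra hxQ
        obtain ⟨w, hw, hwf⟩ := inter_frontier_nonempty_of_isPreconnected hOconn
          (t := Q j y) ⟨x₀, hx₀, fun t ht htB => hj t ht ⟨htB, hx₀C⟩⟩ ⟨x, hx, hxQ⟩
        exact hOE w hw (Or.inr ⟨j, hwf⟩)
      rintro z ⟨hz1, hz2⟩ hzE
      refine hOQ hz1 (z none) hz2 ?_
      change g (fun i => z (some i)) (z none) ∈ E y
      rwa [hgz]

end ThinFamilies

/-! ### Dimension -/

section Dimension

variable {L : FirstOrder.Language.{u, v}} [L.Structure ℝ] {ι κ : Type}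

/-- The projection of `ℝ^ι` to the coordinates in `I`. -/
def restr (I : Finset ι) (x : ι → ℝ) : I → ℝ := fun i => x i

theorem continuous_restr (I : Finset ι) : Continuous (restr I) := by
  unfold restr
  fun_prop

theorem le_defDim [Fintype ι] {A : Set (ι → ℝ)} {I : Finset ι}
    (h : (interior (restr I '' A)).Nonempty) : (I.card : WithBot ℕ) ≤ defDim A := by
  classical
  exact Finset.le_sup (f := fun I : Finset ι => (I.card : WithBot ℕ))
    (Finset.mem_filter.mpr ⟨Finset.mem_univ I, h⟩)

theorem defDim_mono [Fintype ι] {A B : Set (ι → ℝ)} (h : A ⊆ B) : defDim A ≤ defDim B := by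
  classical
  refine Finset.sup_le fun I hI => le_defDim ?_
  exact (Finset.mem_filter.mp hI).2.mono (interior_mono (image_mono h))

theorem defDim_empty [Fintype ι] : defDim (∅ : Set (ι → ℝ)) = ⊥ := by
  simp [defDim]

theorem exists_defDim_eq_card [Fintype ι] {A : Set (ι → ℝ)} (hA : A.Nonempty) :
    ∃ I : Finset ι, (interior (restr I '' A)).Nonempty ∧ defDim A = I.card := by
  classical
  have hne : (Finset.univ.filter fun I : Finset ι => (interior (restr I '' A)).Nonempty).Nonempty :=
    ⟨∅, Finset.mem_filter.mpr ⟨Finset.mem_univ _, by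
      rw [(hA.image (restr ∅)).eq_univ, interior_univ]
      exact univ_nonempty⟩⟩
  obtain ⟨I, hI, h⟩ := Finset.exists_mem_eq_sup _ hne fun I : Finset ι => (I.card : WithBot ℕ)
  exact ⟨I, (Finset.mem_filter.mp hI).2, h⟩

/-- The open box with corners `a` and `b`. -/
def openBox (a b : ι → ℝ) : Set (ι → ℝ) := {z | ∀ i, a i < z i ∧ z i < b i}

theorem isOpen_openBox [Finite ι] (a b : ι → ℝ) : IsOpen (openBox a b) := by
  have : openBox a b = ⋂ i, {z : ι → ℝ | a i < z i ∧ z i < b i} := by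
    ext z; simp [openBox]
  rw [this]
  refine isOpen_iInter_of_finite fun i => ?_
  have h : Continuous fun z : ι → ℝ => z i := continuous_apply i
  exact (isOpen_Ioo (a := a i) (b := b i)).preimage h

theorem isDef_openBox (hL : IsOMinimal L) [Finite ι] (a b : ι → ℝ) : IsDef L (openBox a b) :=
  IsDef.forall_fin fun i => (hL.const_lt i (a i)).and (hL.lt_const i (b i))

/-- If `I` is a set of coordinates of maximal size such that the projection of `S` has interior,
then a further coordinate takes finitely many values over generic points of the projection. -/
theorem exists_open_fibre_finite (hL : IsOMinimal L) [Fintype ι] {S : Set (ι → ℝ)}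
    (hS : IsDef L S) {I : Finset ι} (hI : defDim S = I.card) {j : ι} (hj : j ∉ I)
    {V : Set (I → ℝ)} (hV : IsOpen V) (hne : V.Nonempty) :
    ∃ W ⊆ V, IsOpen W ∧ W.Nonempty ∧
      ∀ x ∈ W, {t | ∃ s, (s ∈ S ∧ ∀ i : I, s i = x i) ∧ s j = t}.Finite := by
  classical
  let A : (I → ℝ) → ℝ → Prop := fun x t => ∃ s : ι → ℝ, (s ∈ S ∧ ∀ i : I, s i = x i) ∧ s j = t
  have hA : IsDef L {z : Option I → ℝ | A (fun i => z (some i)) (z none)} :=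
    IsDef.exists_vec (((hS.comp Sum.inr).and (IsDef.forall_fin fun i => IsDef.eq_var _ _)).and
      (IsDef.eq_var _ _))
  let C : Set (I → ℝ) := {x | ∃ p q, p < q ∧ ∀ t, (p < t ∧ t < q) → A x t}
  have hC : IsDef L C := IsDef.exists_real (IsDef.exists_real ((hL.lt_var _ _).and
    (IsDef.forall_real (((hL.lt_var _ _).and (hL.lt_var _ _)).imp
      (hA.comp fun o => o.elim none fun i => some (some (some i)))))))
  obtain ⟨W, hWV, hW, hWne, hWC | hWC⟩ := hC.exists_open_subset_or_disjoint hL hV hne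
  · exfalso
    obtain ⟨W', -, hW', ⟨x, hx⟩, p, q, hpq, hbox⟩ := exists_box_of_fibres_contain_intervals hL
      hA hW hWne fun x hx => by
        obtain ⟨p, q, hpq, h⟩ := hWC hx
        exact ⟨p, q, hpq, fun t ht => h t ht⟩
    let K : Finset ι := insert j I
    let O : Set (K → ℝ) :=
      {w : K → ℝ | (fun i : I => w ⟨i, Finset.mem_insert_of_mem i.2⟩) ∈ W' ∧
        w ⟨j, Finset.mem_insert_self j I⟩ ∈ Ioo p q}
    have hO : IsOpen O := (hW'.preimage (by fun_prop)).inter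
      (isOpen_Ioo.preimage (continuous_apply _))
    have hOS : O ⊆ restr (insert j I) '' S := by
      rintro w ⟨h1, h2⟩
      obtain ⟨s, ⟨hs, hsI⟩, hsj⟩ := hbox _ h1 _ h2
      refine ⟨s, hs, ?_⟩
      ext ⟨i, hi⟩
      rcases Finset.mem_insert.mp hi with rfl | hi'
      · exact hsj
      · exact hsI ⟨i, hi'⟩
    have hOne : O.Nonempty := by
      refine ⟨fun i => if h : (i : ι) ∈ I then x ⟨i, h⟩ else (p + q) / 2, ?_, ?_⟩
      · simpa using hx
      · simp only [hj, dite_false]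
        constructor <;> linarith
    have h1 := le_defDim (hOne.mono (interior_maximal hOS hO))
    rw [hI, Finset.card_insert_of_notMem hj] at h1
    exact absurd (WithBot.coe_le_coe.mp h1) (by simp)
  · refine ⟨W, hWV, hW, hWne, fun x hx => ?_⟩
    refine hL.finite_of_no_interval (IsDef.fix_real hA x) ?_
    rintro ⟨p, q, hpq, h⟩
    exact hWC x hx ⟨p, q, hpq, fun t ht => h t ht⟩

/-- A nonempty definable set `S` of dimension `d` has a relatively open piece that is the graph of a
continuous map over an open box in `d` of the coordinates. Take a projection to `d` coordinates
with interior; its generic fibres are finite, so each contains a point isolated by a rational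
box, and the Baire category theorem makes the choice of the box constant on an open set. -/
theorem exists_graph_piece (hL : IsOMinimal L) [Fintype ι] {S : Set (ι → ℝ)} (hS : IsDef L S)
    (hne : S.Nonempty) : ∃ I : Finset ι, defDim S = I.card ∧ ∃ (a b : ι → ℝ)
      (φ : (I → ℝ) → (ι → ℝ)), (openBox (restr I a) (restr I b)).Nonempty ∧
      ContinuousOn φ (openBox (restr I a) (restr I b)) ∧
      (∀ x ∈ openBox (restr I a) (restr I b), φ x ∈ S ∧ φ x ∈ openBox a b ∧ restr I (φ x) = x) ∧
      ∀ s ∈ S, s ∈ openBox a b → φ (restr I s) = s := by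
  classical
  obtain ⟨I, hI, hdim⟩ := exists_defDim_eq_card hne
  refine ⟨I, hdim, ?_⟩
  obtain ⟨V, hVS, hV, hVne, hVfin⟩ := exists_open_forall_of_forall_exists_open
    (Q := fun j (W : Set (I → ℝ)) => ∀ x ∈ W,
      {t | ∃ s, (s ∈ S ∧ ∀ i : I, s i = x i) ∧ s j = t}.Finite)
    (fun j V W hVW h x hx => h x (hVW hx)) (Finset.univ \ I) isOpen_interior hI
    (fun j hj V _ hV hVne => exists_open_fibre_finite hL hS hdim (by simpa using hj) hV hVne)
  -- the points over `x` in the box with rational corners `p` and `q` in the other coordinates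
  let In : (ι → ℚ) → (ι → ℚ) → (I → ℝ) → (ι → ℝ) → Prop := fun p q x s =>
    (s ∈ S ∧ ∀ i : I, s i = x i) ∧ ∀ j : ι, j ∉ I → (p j : ℝ) < s j ∧ s j < q j
  let D : (ι → ℚ) × (ι → ℚ) → Set (I → ℝ) := fun c =>
    {x | ∃ s : ι → ℝ, In c.1 c.2 x s ∧ ∀ s' : ι → ℝ, In c.1 c.2 x s' → ∀ j, s' j = s j}
  have hIn : ∀ {γ : Type} [Finite γ] (p q : ι → ℚ) (σ : I → γ) (τ : ι → γ),
      IsDef L {z : γ → ℝ | In p q (fun i => z (σ i)) fun i => z (τ i)} := fun p q σ τ =>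
    ((hS.comp τ).and (IsDef.forall_fin fun i => IsDef.eq_var _ _)).and
      (IsDef.forall_fin fun j => (IsDef.const _).imp ((hL.const_lt _ _).and (hL.lt_const _ _)))
  have hD : ∀ c, IsDef L (D c) := fun c =>
    IsDef.exists_vec ((hIn c.1 c.2 Sum.inl Sum.inr).and (IsDef.forall_vec
      ((hIn c.1 c.2 (fun i => Sum.inl (Sum.inl i)) Sum.inr).imp
        (IsDef.forall_fin fun j => IsDef.eq_var _ _))))
  obtain ⟨⟨p, q⟩, V', hV'V, hV', hV'ne, hV'D⟩ := exists_open_subset_of_countable_cover hL hD hV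
    hVne (by
      intro x hx
      obtain ⟨s, hs, hsx⟩ := interior_subset (hVS hx)
      have hsI : ∀ i : I, s i = x i := fun i => congrFun hsx i
      have hiso : ∀ j, ∃ p q : ℚ, j ∉ I → ((p : ℝ) < s j ∧ s j < q) ∧ ∀ s' : ι → ℝ,
          (s' ∈ S ∧ ∀ i : I, s' i = x i) → ((p : ℝ) < s' j ∧ s' j < q) → s' j = s j := by
        intro j
        by_cases hj : j ∈ I
        · exact ⟨0, 0, fun h => absurd hj h⟩
        have hfin := hVfin j (by simpa using hj) x hx
        set T := {t | ∃ s, (s ∈ S ∧ ∀ i : I, s i = x i) ∧ s j = t} with hT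
        have hnh : (T \ {s j})ᶜ ∈ 𝓝 (s j) :=
          (hfin.subset sdiff_subset).isClosed.isOpen_compl.mem_nhds (by simp)
        obtain ⟨c, d, hcd, hsub⟩ := mem_nhds_iff_exists_Ioo_subset.mp hnh
        obtain ⟨p, hp1, hp2⟩ := exists_rat_btwn hcd.1
        obtain ⟨q, hq1, hq2⟩ := exists_rat_btwn hcd.2
        refine ⟨p, q, fun _ => ⟨⟨hp2, hq1⟩, fun s' hs' hpq => ?_⟩⟩
        by_contra hne
        exact hsub ⟨hp1.trans hpq.1, hpq.2.trans hq2⟩ ⟨⟨s', hs', rfl⟩, hne⟩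
      choose p q hpq using hiso
      refine ⟨(p, q), s, ⟨⟨hs, hsI⟩, fun j hj => (hpq j hj).1⟩, fun s' hs' j => ?_⟩
      by_cases hj : j ∈ I
      · rw [hsI ⟨j, hj⟩, hs'.1.2 ⟨j, hj⟩]
      · exact (hpq j hj).2 s' hs'.1 (hs'.2 j hj))
  choose! φ hφ using fun x (hx : x ∈ D (p, q)) => hx
  have hφfun : ∀ j, IsDefFun L (D (p, q)) fun x => φ x j := by
    intro j
    have h : IsDef L {z : Option I → ℝ | (fun i => z (some i)) ∈ D (p, q) ∧
        ∃ s : ι → ℝ, In p q (fun i => z (some i)) s ∧ s j = z none} :=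
      ((hD (p, q)).comp some).and (IsDef.exists_vec
        ((hIn p q (fun i => Sum.inl (some i)) Sum.inr).and (IsDef.eq_var _ _)))
    refine (congrArg (IsDef L) ?_).mp h
    ext z
    refine and_congr_right fun hz => ⟨?_, fun h => ⟨_, (hφ _ hz).1, h⟩⟩
    rintro ⟨s, hs, hsz⟩
    rw [← hsz, (hφ _ hz).2 s hs j]
  obtain ⟨V'', hV''V', hV'', ⟨x, hx⟩, hcont⟩ := exists_open_forall_of_forall_exists_open
    (Q := fun j (W : Set (I → ℝ)) => ∀ x ∈ W, ContinuousAt (fun x => φ x j) x)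
    (fun j V W hVW h x hx => h x (hVW hx)) Finset.univ hV' hV'ne
    (fun j _ V hVV' hV hVne => (hφfun j).exists_open_continuousAt hL hV hVne (hVV'.trans hV'D))
  obtain ⟨a, b, hab, hbox⟩ := eventually_nhds_iff_box.mp (hV''.mem_nhds hx)
  let a' : ι → ℝ := fun i => if h : i ∈ I then a ⟨i, h⟩ else p i
  let b' : ι → ℝ := fun i => if h : i ∈ I then b ⟨i, h⟩ else q i
  have ha' : restr I a' = a := by ext i; simp [restr, a']
  have hb' : restr I b' = b := by ext i; simp [restr, b']
  have hφx : ∀ x ∈ openBox a b, x ∈ D (p, q) := fun x hx => hV'D (hV''V' (hbox x hx))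
  refine ⟨a', b', φ, ?_, ?_, ?_, ?_⟩
  · rw [ha', hb']
    exact ⟨x, hab⟩
  · rw [ha', hb']
    intro x hx
    exact (continuousAt_pi.mpr fun j => hcont j (Finset.mem_univ j) x
      (hbox x hx)).continuousWithinAt
  · rw [ha', hb']
    intro x hx
    obtain ⟨⟨h1, h2⟩, h3⟩ := (hφ x (hφx x hx)).1
    refine ⟨h1, fun i => ?_, funext h2⟩
    by_cases hi : i ∈ I
    · simp only [a', b', hi, dite_true]
      rw [h2 ⟨i, hi⟩]
      exact hx ⟨i, hi⟩
    · simp only [a', b', hi, dite_false]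
      exact h3 i hi
  · intro s hs hsbox
    have hsx : restr I s ∈ openBox a b := by
      intro i
      have := hsbox i
      simpa [a', b', restr] using this
    refine (funext ((hφ _ (hφx _ hsx)).2 s ⟨⟨hs, fun i => rfl⟩, fun j hj => ?_⟩)).symm
    have := hsbox j
    simpa only [a', b', hj, dite_false] using this

/-- A continuous function on a box that is constant along coordinate directions is constant. -/
theorem eq_of_forall_update_eq [Fintype ι] [DecidableEq ι] {a b : ι → ℝ} {h : (ι → ℝ) → ℝ}
    (hh : ∀ x i t, x ∈ openBox a b → Function.update x i t ∈ openBox a b →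
      h (Function.update x i t) = h x) {x y : ι → ℝ} (hx : x ∈ openBox a b)
    (hy : y ∈ openBox a b) : h y = h x := by
  have hmem : ∀ s : Finset ι, s.piecewise y x ∈ openBox a b := by
    intro s i
    by_cases hi : i ∈ s
    · simpa [hi] using hy i
    · simpa [hi] using hx i
  have key : ∀ s : Finset ι, h (s.piecewise y x) = h x := by
    intro s
    induction s using Finset.induction_on with
    | empty => simp
    | insert i s _ ih =>
      have h1 := hmem (insert i s)
      rw [Finset.piecewise_insert] at h1 ⊢
      rw [hh _ i _ (hmem s) h1, ih]
  simpa using key Finset.univ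

/-- A definable set with a continuous definable injection to `ℝ^e` has dimension at most `e`. On a
graph piece over a box, the first component of the injection has, by the intermediate value
theorem, a level set whose dimension is at most one less, and the other components inject it. -/
theorem defDim_le_of_injective (hL : IsOMinimal L) [Fintype ι] (e : ℕ) :
    ∀ {S : Set (ι → ℝ)} {g : Fin e → (ι → ℝ) → ℝ}, IsDef L S → S.Nonempty →
      (∀ k, IsDefFun L S (g k)) → (∀ k, ContinuousOn (g k) S) →
      (∀ s ∈ S, ∀ s' ∈ S, (∀ k, g k s = g k s') → s = s') → defDim S ≤ e := by
  classical
  induction e with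
  | zero =>
    intro S g hS hne _ _ hinj
    obtain ⟨I, hI, a, b, φ, ⟨x, hx⟩, -, hφ, -⟩ := exists_graph_piece hL hS hne
    rw [hI]
    rcases I.eq_empty_or_nonempty with rfl | ⟨i, hi⟩
    · simp
    · exfalso
      obtain ⟨t, ht1, ht2⟩ := exists_between (hx ⟨i, hi⟩).2
      have hy : Function.update x ⟨i, hi⟩ t ∈ openBox (restr I a) (restr I b) := by
        intro k
        by_cases hk : k = ⟨i, hi⟩
        · subst hk
          simpa using ⟨(hx ⟨i, hi⟩).1.trans ht1, ht2⟩
        · simpa [hk] using hx k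
      have h1 := hinj _ (hφ x hx).1 _ (hφ _ hy).1 fun k => k.elim0
      have h2 := congrArg (restr I) h1
      rw [(hφ x hx).2.2, (hφ _ hy).2.2] at h2
      have h3 := congrFun h2 ⟨i, hi⟩
      simp only [Function.update_self] at h3
      exact ht1.ne h3
  | succ e ih =>
    intro S g hS hne hg hgc hinj
    obtain ⟨I, hI, a, b, φ, ⟨x₀, hx₀⟩, hφc, hφ, -⟩ := exists_graph_piece hL hS hne
    rw [hI]
    set U := openBox (restr I a) (restr I b) with hU
    have hUopen : IsOpen U := isOpen_openBox _ _
    have hh : ContinuousOn (fun x => g 0 (φ x)) U :=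
      (hgc 0).comp hφc fun x hx => (hφ x hx).1
    -- a level set of the first component has dimension at most `e`
    have level : ∀ c, ∀ s ∈ S, g 0 s = c → defDim {s | s ∈ S ∧ g 0 s = c} ≤ e := by
      intro c s hs hsc
      have hF : IsDef L {s | s ∈ S ∧ g 0 s = c} :=
        (hg 0).subst id (P := fun _ t => t = c) (IsDef.eq_const _ _)
      refine ih (g := fun k => g k.succ) hF ⟨s, hs, hsc⟩ (fun k => (hg _).mono hF fun s hs => hs.1)
        (fun k => (hgc _).mono fun s hs => hs.1) fun s hs s' hs' hk => hinj s hs.1 s' hs'.1 ?_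
      exact Fin.cases (hs.2.trans hs'.2.symm) hk
    by_cases hcase : ∃ (x : I → ℝ) (i : I) (t₁ t₂ : ℝ), Function.update x i t₁ ∈ U ∧
        Function.update x i t₂ ∈ U ∧
        g 0 (φ (Function.update x i t₁)) < g 0 (φ (Function.update x i t₂))
    · obtain ⟨x, i, t₁, t₂, h₁, h₂, hlt⟩ := hcase
      obtain ⟨c, hc₁, hc₂⟩ := exists_between hlt
      let J : Finset ι := I.erase i
      have hcard : J.card + 1 = I.card := Finset.card_erase_add_one i.2
      let ins : (J → ℝ) → ℝ → (I → ℝ) := fun w τ k =>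
        if h : k = i then τ else w ⟨k, Finset.mem_erase.mpr ⟨fun h' => h (Subtype.ext h'), k.2⟩⟩
      have hins : Continuous fun p : (J → ℝ) × ℝ => ins p.1 p.2 := by
        refine continuous_pi fun k => ?_
        by_cases hk : k = i
        · simp only [ins, hk, dite_true]
          exact continuous_snd
        · simp only [ins, hk, dite_false]
          exact (continuous_apply _).comp continuous_fst
      let w₀ : J → ℝ := fun k => x ⟨k, Finset.mem_of_mem_erase k.2⟩
      have hw₀ : ∀ τ, ins w₀ τ = Function.update x i τ := by
        intro τ
        ext k
        by_cases hk : k = i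
        · simp [ins, hk]
        · simp [ins, hk, w₀]
      have hinsτ : ∀ τ, Continuous fun w => ins w τ := fun τ =>
        hins.comp (continuous_id.prodMk continuous_const)
      have hev : ∀ τ, Function.update x i τ ∈ U → (∀ᶠ w in 𝓝 w₀, ins w τ ∈ U) ∧
          Tendsto (fun w => g 0 (φ (ins w τ))) (𝓝 w₀) (𝓝 (g 0 (φ (Function.update x i τ)))) := by
        intro τ hτ
        have ht : Tendsto (fun w => ins w τ) (𝓝 w₀) (𝓝 (Function.update x i τ)) := by
          rw [← hw₀]
          exact (hinsτ τ).tendsto w₀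
        exact ⟨ht.eventually (hUopen.mem_nhds hτ),
          (hh.continuousAt (hUopen.mem_nhds hτ)).tendsto.comp ht⟩
      have hmem : ∀ᶠ w in 𝓝 w₀, w ∈ restr J '' {s | s ∈ S ∧ g 0 s = c} := by
        filter_upwards [(hev t₁ h₁).1, (hev t₂ h₂).1, (hev t₁ h₁).2.eventually (gt_mem_nhds hc₁),
          (hev t₂ h₂).2.eventually (lt_mem_nhds hc₂)] with w hw1 hw2 hw3 hw4
        have hseg : ∀ τ ∈ uIcc t₁ t₂, ins w τ ∈ U := by
          intro τ hτ k
          have k1 := hw1 k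
          have k2 := hw2 k
          by_cases hk : k = i
          · simp only [ins, hk, dite_true] at k1 k2 ⊢
            rw [mem_uIcc] at hτ
            rcases hτ with hτ | hτ
            · exact ⟨k1.1.trans_le hτ.1, hτ.2.trans_lt k2.2⟩
            · exact ⟨k2.1.trans_le hτ.1, hτ.2.trans_lt k1.2⟩
          · simpa only [ins, hk, dite_false] using k1
        have hcont : ContinuousOn (fun τ => g 0 (φ (ins w τ))) (uIcc t₁ t₂) :=
          hh.comp (hins.comp (continuous_const.prodMk continuous_id)).continuousOn hseg
        obtain ⟨τ, hτ, hτc⟩ := intermediate_value_uIcc hcont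
          (mem_uIcc.mpr (Or.inl ⟨hw3.le, hw4.le⟩) : c ∈ _)
        refine ⟨φ (ins w τ), ⟨(hφ _ (hseg τ hτ)).1, hτc⟩, ?_⟩
        have h3 := (hφ _ (hseg τ hτ)).2.2
        ext k
        have hki : (⟨k, Finset.mem_of_mem_erase k.2⟩ : I) ≠ i := fun h =>
          (Finset.mem_erase.mp k.2).1 (congrArg Subtype.val h)
        have h4 := congrFun h3 ⟨k, Finset.mem_of_mem_erase k.2⟩
        simp only [ins, hki, dite_false] at h4
        exact h4
      have h5 := le_defDim (I := J) ⟨w₀, mem_interior_iff_mem_nhds.mpr hmem⟩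
      obtain ⟨-, ⟨s, ⟨hs, hsc⟩, -⟩⟩ : _ ∧ w₀ ∈ restr J '' {s | s ∈ S ∧ g 0 s = c} :=
        ⟨trivial, hmem.self_of_nhds⟩
      have h6 := WithBot.coe_le_coe.mp (h5.trans (level c s hs hsc))
      have h7 : I.card ≤ e + 1 := by
        have : J.card ≤ e := h6
        omega
      exact_mod_cast h7
    · push Not at hcase
      have hconst : ∀ y ∈ U, g 0 (φ y) = g 0 (φ x₀) := by
        intro y hy
        refine eq_of_forall_update_eq (h := fun x => g 0 (φ x)) (fun x i t hx hxt => ?_) hx₀ hy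
        have hxi : Function.update x i (x i) ∈ U := by rwa [Function.update_eq_self]
        have h1 := hcase x i t (x i) hxt hxi
        have h2 := hcase x i (x i) t hxi hxt
        rw [Function.update_eq_self] at h1 h2
        exact le_antisymm h2 h1
      have hsub : U ⊆ restr I '' {s | s ∈ S ∧ g 0 s = g 0 (φ x₀)} := fun y hy =>
        ⟨φ y, ⟨(hφ y hy).1, hconst y hy⟩, (hφ y hy).2.2⟩
      have h1 := le_defDim ⟨x₀, interior_maximal hsub hUopen hx₀⟩
      refine (h1.trans (level _ _ (hφ x₀ hx₀).1 rfl)).trans ?_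
      exact_mod_cast e.le_succ

theorem IsDefFun.isDef_image [Finite ι] [Finite κ] {A : Set (ι → ℝ)} {f : (ι → ℝ) → (κ → ℝ)}
    (hA : IsDef L A) (hf : ∀ k, IsDefFun L A fun x => f x k) : IsDef L (f '' A) := by
  have h : IsDef L {y : κ → ℝ | ∃ x : ι → ℝ, x ∈ A ∧
      ∀ k, (fun i => x i) ∈ A ∧ f (fun i => x i) k = y k} :=
    IsDef.exists_vec ((hA.comp Sum.inr).and (IsDef.forall_fin fun k =>
      IsDef.comp (hf k) fun o => o.elim (Sum.inl k) Sum.inr))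
  refine (congrArg (IsDef L) ?_).mp h
  ext y
  exact ⟨fun ⟨x, hx, h⟩ => ⟨x, hx, funext fun k => (h k).2⟩,
    fun ⟨x, hx, h⟩ => ⟨x, hx, fun k => ⟨hx, congrFun h k⟩⟩⟩

/-- Continuous definable injections do not lower the dimension. -/
theorem defDim_le_defDim_image (hL : IsOMinimal L) [Fintype ι] [Fintype κ] {A : Set (ι → ℝ)}
    {f : (ι → ℝ) → (κ → ℝ)} (hA : IsDef L A) (hf : ∀ k, IsDefFun L A fun x => f x k)
    (hfc : ContinuousOn f A) (hinj : InjOn f A) : defDim A ≤ defDim (f '' A) := by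
  rcases A.eq_empty_or_nonempty with rfl | hne
  · simp [defDim_empty]
  obtain ⟨I, hI, a, b, φ, ⟨x₀, hx₀⟩, hφc, hφ, hφ'⟩ := exists_graph_piece hL hA hne
  have hA₀ : IsDef L (A ∩ openBox a b) := hA.inter (isDef_openBox hL a b)
  have hf₀ : ∀ k, IsDefFun L (A ∩ openBox a b) fun x => f x k := fun k =>
    (hf k).mono hA₀ inter_subset_left
  obtain ⟨J, hJ, a', b', ψ, ⟨y₀, hy₀⟩, -, hψ, hψ'⟩ :=
    exists_graph_piece hL (IsDefFun.isDef_image hA₀ hf₀) (Set.Nonempty.image f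
      ⟨φ x₀, (hφ x₀ hx₀).1, (hφ x₀ hx₀).2.1⟩)
  have hA₁ : IsDef L {x | x ∈ A ∩ openBox a b ∧ f x ∈ openBox a' b'} := by
    have h : IsDef L {x | x ∈ A ∩ openBox a b ∧
        ∀ k, x ∈ A ∩ openBox a b ∧ (a' k < f x k ∧ f x k < b' k)} :=
      hA₀.and (IsDef.forall_fin fun k => (hf₀ k).subst id (P := fun _ t => a' k < t ∧ t < b' k)
        ((hL.const_lt _ _).and (hL.lt_const _ _)))
    refine (congrArg (IsDef L) ?_).mp h
    ext x
    exact and_congr_right fun hx => ⟨fun h k => (h k).2, fun h k => ⟨hx, h k⟩⟩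
  set A₁ := {x | x ∈ A ∩ openBox a b ∧ f x ∈ openBox a' b'} with hA₁def
  obtain ⟨⟨x₁, hx₁, hx₁y⟩, hy₁, -⟩ := hψ y₀ hy₀
  have hx₁A₁ : x₁ ∈ A₁ := ⟨hx₁, by rwa [hx₁y]⟩
  have h1 : defDim A₁ ≤ J.card := by
    refine defDim_le_of_injective hL J.card (g := fun k x => f x (J.equivFin.symm k)) hA₁
      ⟨x₁, hx₁A₁⟩ (fun k => (hf _).mono hA₁ fun x hx => hx.1.1)
      (fun k => ((continuous_apply _).comp_continuousOn hfc).mono fun x hx => hx.1.1) ?_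
    intro s hs s' hs' h
    refine hinj hs.1.1 hs'.1.1 ?_
    rw [← hψ' _ (mem_image_of_mem f hs.1) hs.2, ← hψ' _ (mem_image_of_mem f hs'.1) hs'.2]
    congr 1
    ext j
    simpa [restr] using h (J.equivFin j)
  have h2 : (I.card : WithBot ℕ) ≤ defDim A₁ := by
    have hfφ : ContinuousOn (fun x => f (φ x)) (openBox (restr I a) (restr I b)) :=
      hfc.comp hφc fun x hx => (hφ x hx).1
    have hO := hfφ.isOpen_inter_preimage (isOpen_openBox _ _) (isOpen_openBox a' b')
    refine le_defDim (I := I) ⟨restr I x₁, interior_maximal ?_ hO ⟨fun i => hx₁.2 i, ?_⟩⟩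
    · rintro x ⟨hx, hfx⟩
      exact ⟨φ x, ⟨⟨(hφ x hx).1, (hφ x hx).2.1⟩, hfx⟩, (hφ x hx).2.2⟩
    · change f (φ (restr I x₁)) ∈ openBox a' b'
      rw [hφ' x₁ hx₁.1 hx₁.2]
      exact hx₁A₁.2
  rw [hI]
  refine (h2.trans (h1.trans hJ.symm.le)).trans (defDim_mono (image_mono inter_subset_left))

end Dimension

/-! ### Supports of weak limits -/

section Sequences

variable {L : FirstOrder.Language.{u, v}} [L.Structure ℝ] {ι κ : Type}

/-- If the members `V (y n)` of a definable family eventually meet every relatively open piece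
of the definable set `S`, then eventually they contain a relatively open piece of `S` and have
an intersection with `S` of full dimension. Over the box of a graph piece of `S`, the traces of the
`V (y n)` eventually meet each of the finitely many open sets one of which every trace
without interior has to miss. -/
theorem eventually_defDim_inter_eq (hL : IsOMinimal L) [Fintype ι] [Finite κ] {S : Set (ι → ℝ)}
    (hS : IsDef L S) (hne : S.Nonempty) {V : (κ → ℝ) → Set (ι → ℝ)}
    (hV : IsDef L {z : κ ⊕ ι → ℝ | (fun i => z (Sum.inr i)) ∈ V fun k => z (Sum.inl k)})
    {y : ℕ → κ → ℝ}
    (h : ∀ O : Set (ι → ℝ), IsOpen O → (O ∩ S).Nonempty → ∀ᶠ n in atTop,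
      (O ∩ S ∩ V (y n)).Nonempty) :
    ∀ᶠ n in atTop, defDim (S ∩ V (y n)) = defDim S ∧
      ∃ O : Set (ι → ℝ), IsOpen O ∧ (O ∩ S).Nonempty ∧ O ∩ S ⊆ V (y n) := by
  obtain ⟨I, hI, a, b, φ, hbne, hφc, hφ, hφ'⟩ := exists_graph_piece hL hS hne
  set U := openBox (restr I a) (restr I b) with hU
  let T : Set (ι → ℝ) := {s | s ∈ S ∧ s ∈ openBox a b}
  have hT : IsDef L T := hS.and (isDef_openBox hL a b)
  let E : (κ → ℝ) → Set (I → ℝ) := fun w =>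
    {x | ∃ s : ι → ℝ, (s ∈ T ∧ s ∈ V w) ∧ ∀ i : I, s i = x i}
  have hE : IsDef L {z : κ ⊕ I → ℝ | (fun i => z (Sum.inr i)) ∈ E fun k => z (Sum.inl k)} :=
    IsDef.exists_vec (((hT.comp Sum.inr).and
      (hV.comp (Sum.elim (fun k => Sum.inl (Sum.inl k)) Sum.inr))).and
      (IsDef.forall_fin fun i => IsDef.eq_var _ _))
  obtain ⟨F, hF, hFU, hFE⟩ := exists_finite_open_missed hL E hE U (isOpen_openBox _ _) hbne
  have hmeet : ∀ᶠ n in atTop, ∀ O ∈ F, ∃ x ∈ O, x ∈ E (y n) := by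
    rw [eventually_all_finite hF]
    intro O hO
    obtain ⟨hOU, hOo, ⟨x, hx⟩, -⟩ := hFU O hO
    have h1 := h (restr I ⁻¹' O ∩ openBox a b)
      ((hOo.preimage (continuous_restr I)).inter (isOpen_openBox a b))
      ⟨φ x, ⟨by rw [mem_preimage, (hφ x (hOU hx)).2.2]; exact hx, (hφ x (hOU hx)).2.1⟩,
        (hφ x (hOU hx)).1⟩
    refine h1.mono ?_
    rintro n ⟨s, ⟨⟨hsO, hsb⟩, hsS⟩, hsV⟩
    exact ⟨restr I s, hsO, s, ⟨⟨hsS, hsb⟩, hsV⟩, fun i => rfl⟩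
  refine hmeet.mono fun n hn => ?_
  have hint : (interior (E (y n))).Nonempty := by
    by_contra hem
    obtain ⟨O, hO, hOE⟩ := hFE (y n) (not_nonempty_iff_eq_empty.mp hem)
    obtain ⟨x, hx, hxE⟩ := hn O hO
    exact hOE x hx hxE
  have hES : E (y n) ⊆ restr I '' (S ∩ V (y n)) := by
    rintro x ⟨s, ⟨hsT, hsV⟩, hsx⟩
    exact ⟨s, ⟨hsT.1, hsV⟩, funext hsx⟩
  refine ⟨le_antisymm (defDim_mono inter_subset_left) ?_,
    restr I ⁻¹' interior (E (y n)) ∩ openBox a b,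
    (isOpen_interior.preimage (continuous_restr I)).inter (isOpen_openBox a b), ?_, ?_⟩
  · rw [hI]
    exact le_defDim (hint.mono (interior_mono hES))
  · obtain ⟨x, hx⟩ := hint
    obtain ⟨s, ⟨hsT, hsV⟩, hsx⟩ := interior_subset hx
    have : restr I s = x := funext hsx
    exact ⟨s, ⟨by rwa [mem_preimage, this], hsT.2⟩, hsT.1⟩
  · rintro s ⟨⟨hsE, hsb⟩, hsS⟩
    obtain ⟨s', ⟨hsT', hsV'⟩, hs'⟩ := interior_subset hsE
    have h2 : restr I s' = restr I s := funext hs'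
    have h3 : s' = s := by rw [← hφ' s' hsT'.1 hsT'.2, ← hφ' s hsS hsb, h2]
    rwa [← h3]

/-- Definable homeomorphisms preserve the dimension. -/
theorem defDim_image_eq (hL : IsOMinimal L) [Fintype ι] [Fintype κ] {A : Set (ι → ℝ)}
    {f : (ι → ℝ) → (κ → ℝ)} {g : (κ → ℝ) → (ι → ℝ)} (hA : IsDef L A)
    (hf : ∀ k, IsDefFun L A fun x => f x k) (hfc : ContinuousOn f A)
    (hgf : ∀ x ∈ A, g (f x) = x) (hgc : ContinuousOn g (f '' A)) :
    defDim (f '' A) = defDim A := by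
  have hinj : InjOn f A := fun x hx x' hx' h => by rw [← hgf x hx, ← hgf x' hx', h]
  refine le_antisymm ?_ (defDim_le_defDim_image hL hA hf hfc hinj)
  have himg : g '' (f '' A) = A := by
    rw [image_image]
    exact (image_congr hgf).trans (image_id' A)
  have hg : ∀ i, IsDefFun L (f '' A) fun y => g y i := by
    intro i
    have h : IsDef L {z : Option κ → ℝ | ∃ x : ι → ℝ, (x ∈ A ∧
        ∀ k, (fun i => x i) ∈ A ∧ f (fun i => x i) k = z (some k)) ∧ x i = z none} :=
      IsDef.exists_vec (((hA.comp Sum.inr).and (IsDef.forall_fin fun k =>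
        IsDef.comp (hf k) fun o => o.elim (Sum.inl (some k)) Sum.inr)).and (IsDef.eq_var _ _))
    refine (congrArg (IsDef L) ?_).mp h
    ext z
    constructor
    · rintro ⟨x, ⟨hx, hfx⟩, hxi⟩
      have h1 : f x = fun k => z (some k) := funext fun k => (hfx k).2
      refine ⟨⟨x, hx, h1⟩, ?_⟩
      change g (fun k => z (some k)) i = z none
      rw [← h1, hgf x hx]
      exact hxi
    · rintro ⟨⟨x, hx, hfx⟩, hgi⟩
      refine ⟨x, ⟨hx, fun k => ⟨hx, congrFun hfx k⟩⟩, ?_⟩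
      have h1 : g (f x) i = z none := by rw [hfx]; exact hgi
      rwa [hgf x hx] at h1
  have h2 := defDim_le_defDim_image hL (IsDefFun.isDef_image hA hf) hg hgc (by
    rintro _ ⟨x, hx, rfl⟩ _ ⟨x', hx', rfl⟩ h
    rw [hgf x hx, hgf x' hx'] at h
    rw [h])
  rwa [himg] at h2

end Sequences

section WeakLimits

variable {L : FirstOrder.Language.{u, v}} [L.Structure ℝ]

/-- An open set that meets the support of a weak limit eventually meets the supports of the
measures of the sequence. -/
theorem eventually_inter_support_nonempty {X : Type*} [TopologicalSpace X] [MeasurableSpace X]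
    [OpensMeasurableSpace X] [HasOuterApproxClosed X] [HereditarilyLindelofSpace X]
    {ν : ℕ → ProbabilityMeasure X} {νinf : ProbabilityMeasure X}
    (hν : Tendsto ν atTop (𝓝 νinf)) {O : Set X} (hO : IsOpen O)
    (hne : (O ∩ (νinf : Measure X).support).Nonempty) :
    ∀ᶠ n in atTop, (O ∩ (ν n : Measure X).support).Nonempty := by
  obtain ⟨x, hxO, hx⟩ := hne
  have hpos : 0 < (νinf : Measure X) O :=
    (Measure.mem_support_iff_forall x).mp hx O (hO.mem_nhds hxO)
  have h1 := ProbabilityMeasure.le_liminf_measure_open_of_tendsto hν hO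
  refine (eventually_lt_of_lt_liminf (hpos.trans_le h1)).mono fun n hn => ?_
  exact Measure.nonempty_inter_support_of_pos hn

/-- The conclusion for the images of the supports under definable homeomorphisms `τ n` of `X`, where
the conditions `τ n s ∈ V` on `s` belong to a single definable family `W`. -/
theorem eventually_defDim_image_support (hL : IsOMinimal L) {p q : ℕ} {κ : Type} [Finite κ]
    {X : Set (Fin p → ℝ)} {ν : ℕ → ProbabilityMeasure X} {νinf : ProbabilityMeasure X}
    (hν : Tendsto ν atTop (𝓝 νinf)) (hsupp : ∀ᶠ n in atTop, suppIn (ν n) ⊆ suppIn νinf)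
    (hdef : IsDef L (suppIn νinf)) (τ : ℕ → X ≃ₜ X)
    (hτ : ∀ n, IsDef L {z : Fin p ⊕ Fin p → ℝ |
      ∃ s : X, (fun i => z (Sum.inl i)) = s ∧ (fun i => z (Sum.inr i)) = τ n s})
    (y : ℕ → Fin q → ℝ) {V : Set (Fin p ⊕ Fin q → ℝ)}
    {w : ℕ → κ → ℝ} {W : (κ → ℝ) → Set (Fin p → ℝ)}
    (hW : IsDef L {z : κ ⊕ Fin p → ℝ | (fun i => z (Sum.inr i)) ∈ W fun k => z (Sum.inl k)})
    (hWV : ∀ n, ∀ s : X, (s : Fin p → ℝ) ∈ W (w n) ↔ Sum.elim (τ n s : Fin p → ℝ) (y n) ∈ V)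
    (hνV : ∀ᶠ n in atTop,
      prodSet (Subtype.val '' (τ n '' (ν n : Measure X).support)) {y n} ⊆ V) :
    ∀ᶠ n in atTop,
      defDim (prodSet (Subtype.val '' (τ n '' (νinf : Measure X).support)) {y n} ∩ V) =
        defDim (suppIn νinf) ∧
      ContainsOpenPiece V (prodSet (Subtype.val '' (τ n '' (νinf : Measure X).support)) {y n}) := by
  classical
  have hSX : suppIn νinf ⊆ X := by
    rintro _ ⟨s, -, rfl⟩
    exact s.2
  have hne : (suppIn νinf).Nonempty :=
    (Measure.nonempty_support (IsProbabilityMeasure.ne_zero (νinf : Measure X))).image _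
  have key := eventually_defDim_inter_eq hL hdef hne hW (y := w) (by
    rintro O hO ⟨_, hxO, x, hx, rfl⟩
    have h1 := eventually_inter_support_nonempty hν (hO.preimage continuous_subtype_val)
      ⟨x, hxO, hx⟩
    filter_upwards [h1, hsupp, hνV] with n hn hns hnV
    obtain ⟨s, hsO, hs⟩ := hn
    refine ⟨s, ⟨hsO, hns ⟨s, hs, rfl⟩⟩, (hWV n s).mpr (hnV ⟨?_, rfl⟩)⟩
    exact ⟨_, ⟨s, hs, rfl⟩, rfl⟩)
  refine key.mono ?_
  rintro n ⟨hdim, O, hO, hOne, hOW⟩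
  set S := suppIn νinf with hS
  -- the homeomorphism `s ↦ (τ n s, y n)` and its inverse
  let f : (Fin p → ℝ) → (Fin p ⊕ Fin q → ℝ) := fun s =>
    if h : s ∈ X then Sum.elim (τ n ⟨s, h⟩ : Fin p → ℝ) (y n) else 0
  let g : (Fin p ⊕ Fin q → ℝ) → (Fin p → ℝ) := fun z =>
    if h : (fun i => z (Sum.inl i)) ∈ X then ((τ n).symm ⟨_, h⟩ : Fin p → ℝ) else 0
  have hfX : ∀ s : X, f s = Sum.elim (τ n s : Fin p → ℝ) (y n) := fun s => by simp [f]
  have hgf : ∀ s ∈ X, g (f s) = s := by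
    intro s hs
    have h1 := hfX ⟨s, hs⟩
    simp only at h1
    rw [h1]
    simp [g]
  have hE : prodSet (Subtype.val '' (τ n '' (νinf : Measure X).support)) {y n} = f '' S := by
    ext z
    constructor
    · rintro ⟨⟨_, ⟨s, hs, rfl⟩, hsz⟩, hzy⟩
      refine ⟨s, ⟨s, hs, rfl⟩, ?_⟩
      rw [hfX]
      ext i
      rcases i with i | j
      · exact congrFun hsz i
      · exact (congrFun hzy j).symm
    · rintro ⟨_, ⟨s, hs, rfl⟩, rfl⟩
      rw [hfX]
      exact ⟨⟨_, ⟨s, hs, rfl⟩, rfl⟩, rfl⟩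
  have hEV : f '' S ∩ V = f '' (S ∩ W (w n)) := by
    ext z
    constructor
    · rintro ⟨⟨s, hs, rfl⟩, hV⟩
      refine ⟨s, ⟨hs, (hWV n ⟨s, hSX hs⟩).mpr ?_⟩, rfl⟩
      rwa [← hfX]
    · rintro ⟨s, ⟨hs, hsW⟩, rfl⟩
      refine ⟨⟨s, hs, rfl⟩, ?_⟩
      have h1 := (hWV n ⟨s, hSX hs⟩).mp hsW
      rwa [← hfX] at h1
  have hfc : ContinuousOn f X := by
    rw [continuousOn_iff_continuous_domRestrict]
    have h1 : X.domRestrict f = fun s : X => Sum.elim (τ n s : Fin p → ℝ) (y n) := funext hfX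
    rw [h1]
    refine continuous_pi fun i => ?_
    rcases i with i | j
    · exact (continuous_apply i).comp (continuous_subtype_val.comp (τ n).continuous)
    · exact continuous_const
  have hgc : ContinuousOn g {z | (fun i => z (Sum.inl i)) ∈ X} := by
    rw [continuousOn_iff_continuous_domRestrict]
    have h1 : Set.domRestrict {z : Fin p ⊕ Fin q → ℝ | (fun i => z (Sum.inl i)) ∈ X} g =
        fun z => ((τ n).symm ⟨_, z.2⟩ : Fin p → ℝ) := by
      ext1 z
      have hz : (fun i => (z : Fin p ⊕ Fin q → ℝ) (Sum.inl i)) ∈ X := z.2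
      simp [g, hz]
    rw [h1]
    have h2 : Continuous fun (z : Fin p ⊕ Fin q → ℝ) (i : Fin p) => z (Sum.inl i) := by fun_prop
    exact continuous_subtype_val.comp ((τ n).symm.continuous.comp
      (Continuous.subtype_mk (h2.comp continuous_subtype_val) _))
  have hgE : f '' S ⊆ {z | (fun i => z (Sum.inl i)) ∈ X} := by
    rintro _ ⟨s, hs, rfl⟩
    rw [hfX ⟨s, hSX hs⟩]
    exact (τ n ⟨s, hSX hs⟩).2
  have hA : IsDef L (S ∩ W (w n)) :=
    hdef.inter (IsDef.fix (P := fun k x => x ∈ W k) hW (w n))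
  have hf : ∀ k, IsDefFun L (S ∩ W (w n)) fun x => f x k := by
    have hAcomp := hA.comp (some : Fin p → Option (Fin p))
    rintro (i | j)
    · have h : IsDef L {z : Option (Fin p) → ℝ | (fun i => z (some i)) ∈ S ∩ W (w n) ∧
          ∃ t : Fin p → ℝ, (∃ s : X, (fun i => z (some i)) = s ∧ (fun i => t i) = τ n s) ∧
            t i = z none} :=
        hAcomp.and (IsDef.exists_vec (((hτ n).comp
          (Sum.elim (fun i => Sum.inl (some i)) Sum.inr)).and (IsDef.eq_var _ _)))
      refine (congrArg (IsDef L) ?_).mp h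
      ext z
      refine and_congr_right fun hz => ?_
      have h1 := hfX ⟨_, hSX hz.1⟩
      simp only at h1
      change _ ↔ f (fun i => z (some i)) (Sum.inl i) = z none
      rw [h1]
      constructor
      · rintro ⟨t, ⟨s, hs, ht⟩, hti⟩
        have h2 : (⟨_, hSX hz.1⟩ : X) = s := Subtype.ext hs
        rw [h2]
        exact (congrFun ht i).symm.trans hti
      · intro h2
        exact ⟨_, ⟨⟨_, hSX hz.1⟩, rfl, rfl⟩, h2⟩
    · have h : IsDef L {z : Option (Fin p) → ℝ | (fun i => z (some i)) ∈ S ∩ W (w n) ∧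
          z none = y n j} := hAcomp.and (IsDef.eq_const _ _)
      refine (congrArg (IsDef L) ?_).mp h
      ext z
      refine and_congr_right fun hz => ?_
      have h1 := hfX ⟨_, hSX hz.1⟩
      simp only at h1
      change _ ↔ f (fun i => z (some i)) (Sum.inr j) = z none
      rw [h1]
      exact eq_comm
  rw [hE, hEV]
  refine ⟨?_, ?_⟩
  · rw [← hdim]
    exact defDim_image_eq hL hA hf (hfc.mono (inter_subset_left.trans hSX))
      (fun s hs => hgf s (hSX hs.1)) (hgc.mono ((image_mono inter_subset_left).trans hgE))
  · obtain ⟨U, hU, hUeq⟩ := continuousOn_iff'.mp (hgc.mono hgE) O hO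
    have hUmem : ∀ s ∈ S, f s ∈ U ↔ s ∈ O := by
      intro s hs
      have h1 : f s ∈ g ⁻¹' O ∩ f '' S ↔ f s ∈ U ∩ f '' S := by rw [hUeq]
      have h2 : f s ∈ f '' S := mem_image_of_mem f hs
      simp only [mem_inter_iff, h2, and_true, mem_preimage, hgf s (hSX hs)] at h1
      exact h1.symm
    obtain ⟨s, hsO, hs⟩ := hOne
    refine ⟨U, hU, ⟨f s, (hUmem s hs).mpr hsO, mem_image_of_mem f hs⟩, ?_⟩
    rintro _ ⟨hzU, s, hs, rfl⟩
    have h1 : f s ∈ f '' S ∩ V := by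
      rw [hEV]
      exact ⟨s, ⟨hs, hOW ⟨(hUmem s hs).mp hzU, hs⟩⟩, rfl⟩
    exact h1.2

end WeakLimits

theorem mainTheorem9 (L : FirstOrder.Language.{u, v}) [L.Structure ℝ] (hL : IsOMinimal L)
    {p q : ℕ} (X : Set (Fin p → ℝ)) (Y : Set (Fin q → ℝ)) (hXY : IsDef L (prodSet X Y))
    (y : ℕ → Y) (ν : ℕ → ProbabilityMeasure X) (νinf : ProbabilityMeasure X)
    (hν : Tendsto ν atTop (𝓝 νinf))
    (hsupp : ∀ᶠ n in atTop, suppIn (ν n) ⊆ suppIn νinf)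
    (hdef : IsDef L (suppIn νinf))
    (hnull : ∀ A : Set (Fin p → ℝ), IsDef L A → A ⊆ suppIn νinf →
      defDim A < defDim (suppIn νinf) →
      (νinf : Measure X) ((Subtype.val : X → (Fin p → ℝ)) ⁻¹' A) = 0) :
    (∀ V : Set (Fin p ⊕ Fin q → ℝ), V ⊆ prodSet X Y → IsDef L V →
      (∀ᶠ n in atTop, prodSet (suppIn (ν n)) {(y n : Fin q → ℝ)} ⊆ V) →
      ∀ᶠ n in atTop,
        defDim (prodSet (suppIn νinf) {(y n : Fin q → ℝ)} ∩ V) = defDim (suppIn νinf) ∧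
        ContainsOpenPiece V (prodSet (suppIn νinf) {(y n : Fin q → ℝ)})) ∧
    (∀ [Group X], IsDefinableLieGroup L X →
      ∀ (x : ℕ → X) (xinf : X), Tendsto x atTop (𝓝 xinf) →
      ∀ V : Set (Fin p ⊕ Fin q → ℝ), V ⊆ prodSet X Y → IsDef L V →
      (∀ᶠ n in atTop, prodSet (suppTranslate (ν n) (x n)) {(y n : Fin q → ℝ)} ⊆ V) →
      ∀ᶠ n in atTop,
        defDim (prodSet (suppTranslate νinf (x n)) {(y n : Fin q → ℝ)} ∩ V) =
          defDim (suppIn νinf) ∧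
        ContainsOpenPiece V (prodSet (suppTranslate νinf (x n)) {(y n : Fin q → ℝ)})) := by
  constructor
  · intro V hVXY hV hνV
    -- `X` is the fibre of `X × Y` over any point of `Y`
    have hX : IsDef L X := by
      refine (congrArg (IsDef L) ?_).mp (IsDef.fix (P := fun (b : Fin q → ℝ) (a : Fin p → ℝ) =>
        a ∈ X ∧ b ∈ Y) (hXY.comp (ι := Fin q ⊕ Fin p) (Sum.elim Sum.inr Sum.inl)) (y 0))
      ext a
      exact and_iff_left (y 0).2
    have hτ : IsDef L {z : Fin p ⊕ Fin p → ℝ | ∃ s : X, (fun i => z (Sum.inl i)) = s ∧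
        (fun i => z (Sum.inr i)) = Homeomorph.refl X s} := by
      refine (congrArg (IsDef L) ?_).mp ((hX.comp Sum.inl).and
        (IsDef.forall_fin fun i => IsDef.eq_var (Sum.inr i) (Sum.inl i)))
      ext z
      constructor
      · rintro ⟨h1, h2⟩
        exact ⟨⟨_, h1⟩, rfl, funext h2⟩
      · rintro ⟨s, h1, h2⟩
        exact ⟨h1 ▸ s.2, congrFun (h2.trans h1.symm)⟩
    have hW : IsDef L {z : Fin q ⊕ Fin p → ℝ | (fun i => z (Sum.inr i)) ∈
        {s : Fin p → ℝ | Sum.elim s (fun k => z (Sum.inl k)) ∈ V}} := by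
      refine (congrArg (IsDef L) ?_).mp (hV.comp (Sum.elim Sum.inr Sum.inl))
      ext z
      refine iff_of_eq (congrArg (· ∈ V) ?_)
      ext i
      cases i <;> rfl
    have h := eventually_defDim_image_support hL hν hsupp hdef (fun _ => Homeomorph.refl X)
      (fun _ => hτ) (fun n => (y n : Fin q → ℝ)) (V := V) (w := fun n => (y n : Fin q → ℝ))
      (W := fun b => {s | Sum.elim s b ∈ V}) hW (fun n s => Iff.rfl)
      (by simpa [suppIn] using hνV)
    simpa [suppIn] using h
  · intro _ hG x xinf _ V hVXY hV hνV
    obtain ⟨hΓ, d, _, hLie⟩ := hG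
    have hmul : ContinuousMul X :=
      continuousMul_of_contMDiffMul 𝓘(ℝ, EuclideanSpace ℝ (Fin d)) ∞
    set Γ := {z : (Fin p ⊕ Fin p) ⊕ Fin p → ℝ |
      ∃ a b : X, z = Sum.elim (Sum.elim (a : Fin p → ℝ) (b : Fin p → ℝ))
      ((a * b : X) : Fin p → ℝ)} with hΓdef
    have hΓmem : ∀ z, z ∈ Γ ↔ ∃ a b : X, ((fun i => z (Sum.inl (Sum.inl i))) = a ∧
        (fun i => z (Sum.inl (Sum.inr i))) = b) ∧ (fun i => z (Sum.inr i)) = (a * b : X) := by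
      intro z
      constructor
      · rintro ⟨a, b, rfl⟩
        exact ⟨a, b, ⟨rfl, rfl⟩, rfl⟩
      · rintro ⟨a, b, ⟨h1, h2⟩, h3⟩
        refine ⟨a, b, ?_⟩
        rw [← h1, ← h2, ← h3]
        ext ((i | i) | i) <;> rfl
    have hΓ' : IsDef L {z | ∃ a b : X, ((fun i => z (Sum.inl (Sum.inl i))) = (a : Fin p → ℝ) ∧
        (fun i => z (Sum.inl (Sum.inr i))) = (b : Fin p → ℝ)) ∧
        (fun i => z (Sum.inr i)) = ((a * b : X) : Fin p → ℝ)} := by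
      refine (congrArg (IsDef L) ?_).mp hΓ
      ext z
      exact hΓmem z
    have hτ : ∀ n, IsDef L {z : Fin p ⊕ Fin p → ℝ | ∃ s : X, (fun i => z (Sum.inl i)) = s ∧
        (fun i => z (Sum.inr i)) = Homeomorph.mulRight (x n) s} := by
      intro n
      have h := IsDef.fix (P := fun (c : Fin p → ℝ) (z : Fin p ⊕ Fin p → ℝ) =>
        ∃ a b : X, ((fun i => z (Sum.inl i)) = (a : Fin p → ℝ) ∧
          (fun i => c i) = (b : Fin p → ℝ)) ∧ (fun i => z (Sum.inr i)) = ((a * b : X) : Fin p → ℝ))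
        (hΓ'.comp (Sum.elim (Sum.elim (fun i => Sum.inr (Sum.inl i)) Sum.inl)
          fun i => Sum.inr (Sum.inr i))) (x n)
      refine (congrArg (IsDef L) ?_).mp h
      ext z
      constructor
      · rintro ⟨a, b, ⟨h1, h2⟩, h3⟩
        have h4 : x n = b := Subtype.ext h2
        exact ⟨a, h1, by rw [h3, ← h4]; rfl⟩
      · rintro ⟨a, h1, h2⟩
        exact ⟨a, x n, ⟨h1, rfl⟩, h2⟩
    -- the family of the sets `{s | (s * b, y) ∈ V}` with parameters `(b, y)`
    let W : (Fin p ⊕ Fin q → ℝ) → Set (Fin p → ℝ) := fun c => {s | ∃ t : Fin p → ℝ,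
      (∃ a b : X, ((fun i => s i) = (a : Fin p → ℝ) ∧
        (fun i => c (Sum.inl i)) = (b : Fin p → ℝ)) ∧
        (fun i => t i) = ((a * b : X) : Fin p → ℝ)) ∧
      Sum.elim (fun i => t i) (fun j => c (Sum.inr j)) ∈ V}
    have hW : IsDef L {z : (Fin p ⊕ Fin q) ⊕ Fin p → ℝ |
        (fun i => z (Sum.inr i)) ∈ W fun k => z (Sum.inl k)} := by
      refine IsDef.exists_vec (IsDef.and (hΓ'.comp (Sum.elim (Sum.elim
        (fun i => Sum.inl (Sum.inr i)) (fun i => Sum.inl (Sum.inl (Sum.inl i)))) Sum.inr)) ?_)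
      refine (congrArg (IsDef L) ?_).mp (hV.comp (Sum.elim Sum.inr
        fun j => Sum.inl (Sum.inl (Sum.inr j))))
      ext z
      refine iff_of_eq (congrArg (· ∈ V) ?_)
      ext i
      cases i <;> rfl
    exact eventually_defDim_image_support hL hν hsupp hdef (fun n => Homeomorph.mulRight (x n))
      hτ (fun n => (y n : Fin q → ℝ)) (V := V)
      (w := fun n => Sum.elim (x n : Fin p → ℝ) (y n : Fin q → ℝ)) (W := W) hW
      (fun n s => by
        constructor
        · rintro ⟨t, ⟨a, b, ⟨h1, h2⟩, h3⟩, h4⟩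
          have h5 : s = a := Subtype.ext h1
          have h6 : x n = b := Subtype.ext h2
          subst h5 h6
          rw [h3] at h4
          exact h4
        · intro h
          exact ⟨_, ⟨s, x n, ⟨rfl, rfl⟩, rfl⟩, h⟩)
      hνV
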